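/- Let $G=\{e^{i m\pi/2^n}\mid m\in\mathbb Z,\ n\ge 1\}$, a subgroup of the circle group $\{z\in\mathbb C\mid |z|=1\}$ (so $G\cong\mathbb Z[\tfrac12]/\mathbb Z$), let $S=\{e^{i\pi/2^n}\mid n\ge 1\}$, and let $X=\mathsf{Cay}(G,S)$ be the Cayley digraph with vertex set $G$ and arrows $(g,gs)$, $g\in G$, $s\in S$. Let $\mathbb K$ be any commutative ring. Then for every $n\ge 0$ there is an isomorphism of $\mathbb K$-modules $$\mathsf{PH}_n(\mathsf{Cay}(G,S))\cong H_n(S^1;\mathbb K),$$ where the right-hand side is the singular homology of the circle with coefficients in $\mathbb K$ and $\mathsf{PH}_*$ is the path homology (GLMY homology) with coefficients in $\mathbb K$, defined as follows. A sequence of vertices $(x_0,\dots,x_n)$ is a path if each $(x_i,x_{i+1})$ is an arrow or $x_i=x_{i+1}$, and it is accessible if for each $i<n$ there is a path from $x_i$ to $x_{i+1}$. Let $\mathcal R_n(X)$ be the free $\mathbb K$-module on the accessible sequences $(x_0,\dots,x_n)$ modulo the span of those with $x_i=x_{i+1}$ for some $i<n$, with the differential $\partial[x_0,\dots,x_n]=\sum_{i=0}^n(-1)^i[x_0,\dots,\widehat{x_i},\dots,x_n]$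 for $n\ge1$; let $\mathcal A_n(X)\subseteq\mathcal R_n(X)$ be the span of the classes of paths; let $\Omega_0(X)=\mathcal A_0(X)$ and $\Omega_n(X)=\mathcal A_n(X)\cap\partial^{-1}(\mathcal A_{n-1}(X))$ for $n\ge 1$. Then $\mathsf{PH}_n(X)=H_n(\Omega(X),\partial)$. -/

import Mathlib

open CategoryTheory

universe u

noncomputable section

namespace PathHomology

section Digraphs

variable {V : Type} (X : Digraph V)

/-- `(x, y) ∈ X₁ = A(X) ∪ Δ(X₀)`: either `x = y` or there is an arrow from `x` to `y`.
(Loops of a Mathlib digraph thus play no role.) -/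
def Step (x y : V) : Prop := x = y ∨ X.Adj x y

/-- `dist(x, y) < ∞`: there is a path (a finite sequence of steps) from `x` to `y`. -/
def Reach (x y : V) : Prop := Relation.ReflTransGen (Step X) x y

/-- The sequence `(x₀, …, xₙ)` is accessible: `dist(xᵢ, xᵢ₊₁) < ∞` for all `i < n`. -/
def IsAccessible {n : ℕ} (x : Fin (n + 1) → V) : Prop :=
  ∀ i : Fin n, Reach X (x i.castSucc) (x i.succ)

/-- The sequence `(x₀, …, xₙ)` is an `n`-path: `(xᵢ, xᵢ₊₁) ∈ X₁` for all `i < n`. -/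
def IsPath {n : ℕ} (x : Fin (n + 1) → V) : Prop :=
  ∀ i : Fin n, Step X (x i.castSucc) (x i.succ)

/-- The sequence `(x₀, …, xₙ)` is regular: `xᵢ ≠ xᵢ₊₁` for all `i < n`. -/
def IsRegular {n : ℕ} (x : Fin (n + 1) → V) : Prop :=
  ∀ i : Fin n, x i.castSucc ≠ x i.succ

/-- Accessible sequences `(x₀, …, xₙ)`. -/
def AccSeq (n : ℕ) : Type := {x : Fin (n + 1) → V // IsAccessible X x}

variable {X}

theorem IsAccessible.reach {n : ℕ} {x : Fin (n + 1) → V} (hx : IsAccessible X x)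
    {i j : Fin (n + 1)} (hij : i ≤ j) : Reach X (x i) (x j) := by
  induction j using Fin.induction with
  | zero =>
    obtain rfl : i = 0 := Fin.le_zero_iff.mp hij
    exact Relation.ReflTransGen.refl
  | succ j ih =>
    rcases hij.eq_or_lt with rfl | h
    · exact Relation.ReflTransGen.refl
    · exact (ih (Fin.le_castSucc_iff.mpr h)).trans (hx j)

/-- The face `(x₀, …, x̂ᵢ, …, xₙ₊₁)` obtained by omitting the `i`-th entry. -/
def AccSeq.face {n : ℕ} (i : Fin (n + 2)) (x : AccSeq X (n + 1)) : AccSeq X n :=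
  ⟨fun k => x.1 (i.succAbove k), fun k =>
    x.2.reach ((Fin.strictMono_succAbove i).monotone (Fin.castSucc_lt_succ (i := k)).le)⟩

theorem AccSeq.face_face {n : ℕ} {i j : Fin (n + 2)} (hij : i ≤ j) (x : AccSeq X (n + 2)) :
    (x.face j.succ).face i = (x.face i.castSucc).face j := by
  apply Subtype.ext
  funext k
  simp only [face]
  simp only [Fin.succAbove, Fin.lt_def, Fin.le_def] at *
  split_ifs <;> simp_all <;> omega

theorem AccSeq.face_eq_of_not_regular {n : ℕ} (x : AccSeq X (n + 1)) {k : Fin (n + 1)}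
    (hk : x.1 k.castSucc = x.1 k.succ) : x.face k.castSucc = x.face k.succ := by
  apply Subtype.ext
  funext m
  simp only [face]
  by_cases hm : m = k
  · subst hm
    simp [hk]
  · simp only [Fin.succAbove, Fin.lt_def, Fin.ext_iff] at *
    split_ifs <;> simp_all <;> omega

theorem AccSeq.face_not_regular {n : ℕ} (x : AccSeq X (n + 1)) {k : Fin (n + 1)}
    (hk : x.1 k.castSucc = x.1 k.succ) {i : Fin (n + 2)} (h₁ : i ≠ k.castSucc)
    (h₂ : i ≠ k.succ) : ¬ IsRegular (x.face i).1 := by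
  intro hreg
  rcases lt_or_ge i k.castSucc with h | h
  · have hn : (k : ℕ) - 1 < n := by
      have := k.2
      have : (i : ℕ) < k := h
      omega
    refine hreg ⟨(k : ℕ) - 1, hn⟩ ?_
    have hpos : (i : ℕ) < k := h
    have e₁ : i.succAbove (Fin.castSucc ⟨(k : ℕ) - 1, hn⟩) = k.castSucc := by
      simp only [Fin.succAbove, Fin.lt_def, Fin.ext_iff]
      split_ifs <;> simp_all <;> omega
    have e₂ : i.succAbove (Fin.succ ⟨(k : ℕ) - 1, hn⟩) = k.succ := by
      simp only [Fin.succAbove, Fin.lt_def, Fin.ext_iff]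
      split_ifs <;> simp_all <;> omega
    simp only [face, e₁, e₂, hk]
  · have hlt : (k : ℕ) + 1 < i := by
      have h' : (k : ℕ) ≤ i := h
      have h₁' : (i : ℕ) ≠ k := fun e => h₁ (Fin.ext e)
      have h₂' : (i : ℕ) ≠ k + 1 := fun e => h₂ (Fin.ext e)
      omega
    have hn : (k : ℕ) < n := by
      have := i.2
      omega
    refine hreg ⟨(k : ℕ), hn⟩ ?_
    have e₁ : i.succAbove (Fin.castSucc ⟨(k : ℕ), hn⟩) = k.castSucc := by
      simp only [Fin.succAbove, Fin.lt_def, Fin.ext_iff]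
      split_ifs <;> simp_all <;> omega
    have e₂ : i.succAbove (Fin.succ ⟨(k : ℕ), hn⟩) = k.succ := by
      simp only [Fin.succAbove, Fin.lt_def, Fin.ext_iff]
      split_ifs <;> simp_all
    simp only [face, e₁, e₂, hk]

end Digraphs

section Complexes

variable (K : Type u) [CommRing K] {V : Type} (X : Digraph V)

/-- `Λₙ(X)`: the free `K`-module on accessible sequences `(x₀, …, xₙ)`. -/
abbrev Lam (n : ℕ) : Type u := AccSeq X n →₀ K

/-- `∂(x₀, …, xₙ₊₁) = ∑ᵢ (-1)ⁱ (x₀, …, x̂ᵢ, …, xₙ₊₁)` on `Λ(X)`. -/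
def lamD (n : ℕ) : Lam K X (n + 1) →ₗ[K] Lam K X n :=
  ∑ i : Fin (n + 2), (-1 : K) ^ (i : ℕ) • Finsupp.lmapDomain K K (AccSeq.face i)

theorem lamD_single (n : ℕ) (x : AccSeq X (n + 1)) (a : K) :
    lamD K X n (Finsupp.single x a) =
      ∑ i : Fin (n + 2), (-1 : K) ^ (i : ℕ) • Finsupp.single (x.face i) a := by
  simp [lamD]

theorem lamD_lamD (n : ℕ) : lamD K X n ∘ₗ lamD K X (n + 1) = 0 := by
  apply Finsupp.lhom_ext
  intro x a
  simp only [LinearMap.comp_apply, lamD_single, map_sum, map_smul, LinearMap.zero_apply,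
    Finset.smul_sum]
  rw [← Finset.sum_product', Finset.univ_product_univ]
  let S : Finset (Fin (n + 3) × Fin (n + 2)) := {ij | (ij.1 : ℕ) ≤ (ij.2 : ℕ)}
  rw [← Finset.sum_add_sum_compl S, ← eq_neg_iff_add_eq_zero, ← Finset.sum_neg_distrib]
  refine Finset.sum_bij
    (fun ij hij => (ij.2.succ, Fin.castLT ij.1
      (lt_of_le_of_lt (Finset.mem_filter.mp hij).2 ij.2.is_lt))) ?_ ?_ ?_ ?_
  · rintro ⟨i, j⟩ hij
    simp only [S, Finset.compl_filter, Finset.mem_filter_univ] at hij ⊢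
    simp only [Fin.val_succ, Fin.val_castLT]
    omega
  · rintro ⟨i, j⟩ hij ⟨i', j'⟩ hij' h
    simp only [Prod.mk.injEq, Fin.ext_iff, Fin.val_succ, Fin.val_castLT] at h ⊢
    omega
  · rintro ⟨i, j⟩ hij
    simp only [S, Finset.compl_filter, Finset.mem_filter_univ, not_le] at hij
    have hi : i ≠ 0 := by
      rintro rfl
      simp at hij
    refine ⟨(j.castSucc, i.pred hi), ?_, ?_⟩
    · simp [S]
      omega
    · simp
  · rintro ⟨i, j⟩ hij
    have hij' : (i : ℕ) ≤ (j : ℕ) := (Finset.mem_filter.mp hij).2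
    have hf := AccSeq.face_face (i := Fin.castLT i (lt_of_le_of_lt hij' j.is_lt)) (j := j)
      hij' x
    simp only [Fin.castSucc_castLT] at hf
    simp only [smul_smul, ← neg_smul, hf, Fin.val_succ, Fin.val_castLT]
    congr 1
    ring

/-- `Dₙ(X) ⊆ Λₙ(X)`: the span of the non-regular accessible sequences. -/
def degenerate (n : ℕ) : Submodule K (Lam K X n) :=
  Submodule.span K {a | ∃ x : AccSeq X n, ¬ IsRegular x.1 ∧ a = Finsupp.single x 1}

theorem degenerate_le_comap (n : ℕ) :
    degenerate K X (n + 1) ≤ (degenerate K X n).comap (lamD K X n) := by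
  refine Submodule.span_le.mpr ?_
  rintro _ ⟨x, hx, rfl⟩
  obtain ⟨k, hk⟩ : ∃ k : Fin (n + 1), x.1 k.castSucc = x.1 k.succ := by
    simpa [IsRegular] using hx
  have hne : k.castSucc ≠ k.succ := (Fin.castSucc_lt_succ (i := k)).ne
  simp only [Submodule.comap_coe, Set.mem_preimage, SetLike.mem_coe, lamD_single]
  rw [← Finset.add_sum_erase _ _ (Finset.mem_univ k.castSucc),
    ← Finset.add_sum_erase _ _ (Finset.mem_erase.mpr ⟨hne.symm, Finset.mem_univ k.succ⟩),
    ← add_assoc, x.face_eq_of_not_regular hk, ← add_smul]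
  have h0 : (-1 : K) ^ (k.castSucc : ℕ) + (-1 : K) ^ (k.succ : ℕ) = 0 := by
    simp [pow_succ]
  rw [h0, zero_smul, zero_add]
  refine Submodule.sum_mem _ fun i hi => Submodule.smul_mem _ _ (Submodule.subset_span ?_)
  simp only [Finset.mem_erase] at hi
  exact ⟨x.face i, x.face_not_regular hk hi.2.1 hi.1, rfl⟩

/-- `𝓡ₙ(X) = Λₙ(X) / Dₙ(X)`. -/
abbrev Reg (n : ℕ) : Type u := Lam K X n ⧸ degenerate K X n

/-- The differential of `𝓡(X)`, induced by that of `Λ(X)`. -/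
def regD (n : ℕ) : Reg K X (n + 1) →ₗ[K] Reg K X n :=
  (degenerate K X (n + 1)).mapQ (degenerate K X n) (lamD K X n) (degenerate_le_comap K X n)

theorem regD_regD (n : ℕ) (a : Reg K X (n + 2)) : regD K X n (regD K X (n + 1) a) = 0 := by
  obtain ⟨b, rfl⟩ := Submodule.mkQ_surjective _ a
  have h := LinearMap.congr_fun (lamD_lamD K X n) b
  simp only [LinearMap.comp_apply, LinearMap.zero_apply] at h
  simp [regD, h]

/-- `𝓐ₙ(X) ⊆ 𝓡ₙ(X)`: the span of the classes `[x₀, …, xₙ]` of the `n`-paths of `X`. -/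
def allowed (n : ℕ) : Submodule K (Reg K X n) :=
  Submodule.span K {a | ∃ x : AccSeq X n, IsPath X x.1 ∧
    a = (degenerate K X n).mkQ (Finsupp.single x 1)}

/-- `Ωₙ(X) = 𝓐ₙ(X) ∩ ∂⁻¹(𝓐ₙ₋₁(X))`, with `Ω₀(X) = 𝓐₀(X)`. -/
def Omega : (n : ℕ) → Submodule K (Reg K X n)
  | 0 => allowed K X 0
  | n + 1 => allowed K X (n + 1) ⊓ (allowed K X n).comap (regD K X n)

theorem regD_mem_Omega (n : ℕ) (a : Reg K X (n + 1)) (ha : a ∈ Omega K X (n + 1)) :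
    regD K X n a ∈ Omega K X n := by
  cases n with
  | zero => exact ha.2
  | succ n => exact ⟨ha.2, by simp [regD_regD]⟩

/-- The differential of `Ω(X)`, restricted from `𝓡(X)`. -/
def omegaD (n : ℕ) : Omega K X (n + 1) →ₗ[K] Omega K X n :=
  (regD K X n).restrict (regD_mem_Omega K X n)

/-- The chain complex `Ω(X)` of path chains. -/
def omegaComplex : ChainComplex (ModuleCat.{u} K) ℕ :=
  ChainComplex.of (fun n => ModuleCat.of K (Omega K X n)) (fun n => ModuleCat.ofHom (omegaD K X n))
    (fun n => by
      rw [← ModuleCat.ofHom_comp]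
      exact congrArg ModuleCat.ofHom
        (LinearMap.ext fun a => Subtype.ext (regD_regD K X n a.1)))

/-- Path homology (GLMY homology) `PHₙ(X) = Hₙ(Ω(X))` with coefficients in `K`. -/
def PH (n : ℕ) : ModuleCat.{u} K := (omegaComplex K X).homology n

end Complexes

/-- The Cayley digraph `Cay(G, S)`: vertices `G`, arrows `(g, g s)` with `s ∈ S`. -/
def Cay (G : Type) [Group G] (S : Set G) : Digraph G where
  Adj g h := ∃ s ∈ S, h = g * s

/-- The subgroup `{e^{i m π / 2ⁿ} | m ∈ ℤ, n ≥ 1}` of the circle group. -/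
def dyadicCircle : Subgroup Circle where
  carrier := {z | ∃ (m : ℤ) (n : ℕ), 1 ≤ n ∧ z = Circle.exp (m * Real.pi / 2 ^ n)}
  one_mem' := ⟨0, 1, le_rfl, by simp⟩
  mul_mem' := by
    rintro _ _ ⟨m, n, hn, rfl⟩ ⟨m', n', -, rfl⟩
    refine ⟨m * 2 ^ n' + m' * 2 ^ n, n + n', by omega, ?_⟩
    rw [← Circle.exp_add]
    congr 1
    push_cast
    field_simp
    ring
  inv_mem' := by
    rintro _ ⟨m, n, hn, rfl⟩
    refine ⟨-m, n, hn, ?_⟩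
    rw [← Circle.exp_neg]
    congr 1
    push_cast
    ring

/-- The generating set `{e^{i π / 2ⁿ} | n ≥ 1}`. -/
def dyadicGenerators : Set dyadicCircle :=
  {z | ∃ n : ℕ, 1 ≤ n ∧ (z : Circle) = Circle.exp (Real.pi / 2 ^ n)}

end PathHomology

end

/-! Both sides are computed separately: each is `K` in degrees 0 and 1 and zero above.

For the circle, let `t` be translation by `2π` on the line. Simplices are contractible, so they lift
through `ℝ → S¹`, uniquely up to powers of `t`. Hence `0 → C(ℝ) → C(ℝ) → C(S¹) → 0`, with first map
`t - 1`, is exact (`translationShortComplex_circle_shortExact`). Since `ℝ` is contractible and `t`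
is homotopic to the identity, the long exact sequence gives the homology.

For the digraph, `floorMap N` rounds arguments down to multiples of `2π / 2ᴺ`. For `N ≥ 2` it sends
steps to steps (`isStepHom_floorMap`), and `floorMap N z` is at most one step away from `floorMap (N
+ 1) z` (`step_floorMap`), so successive floor maps are joined by a prism homotopy. A chain has
finitely many vertices and is therefore fixed by `floorMap N` for large `N`. Thus every cycle of
positive degree is homologous to its image under `floorMap 2`, which lives on the directed square of
fourth roots of unity. Regular paths there consist of quarter turns, and omitting an inner vertex
creates a half turn, which is not an arrow; so the square has no nonzero path chains of degree at
least 2 (`regMap_floorMap_eq_zero`). In degree 1 only the multiples of the sum of the four quarter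
turns survive, and in degree 0 everything follows from the vertex 1 reaching every vertex. -/

section Singular

/-! ### Singular homology of the circle, from its universal covering. -/

open Limits Simplicial AlgebraicTopology

/-- A map from a contractible space lifts through a covering map. -/
theorem IsCoveringMap.exists_lift_of_contractible {A E X : Type*} [TopologicalSpace A]
    [TopologicalSpace E] [TopologicalSpace X] [ContractibleSpace A] {p : E → X}
    (hp : IsCoveringMap p) (hs : Function.Surjective p) (f : C(A, X)) :
    ∃ F : C(A, E), ∀ a, p (F a) = f a := by
  obtain ⟨a₀, ⟨h⟩⟩ := id_nullhomotopic A
  obtain ⟨e₀, he⟩ := hs (f a₀)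
  -- The reversed contraction makes `H` constant at time 0, where it lifts to `e₀`; the lift at time
  -- 1 lies over `f`.
  let H : C(unitInterval × A, X) := f.comp h.symm.toContinuousMap
  refine ⟨(hp.liftHomotopy H (.const A e₀) (fun a => ?_)).comp
    ((ContinuousMap.const A 1).prodMk (.id A)), fun a => ?_⟩
  · simp [H, he]
  · have := congrFun (hp.liftHomotopy_lifts H (.const A e₀) (fun a => by simp [H, he])) (1, a)
    simpa [H] using this

/-- Every sequence indexed by `ℤ` is the sequence of differences of another one. -/
theorem Int.exists_add_one_eq_add {M : Type*} [AddCommGroup M] (b : ℤ → M) :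
    ∃ P : ℤ → M, P 0 = 0 ∧ ∀ k, P (k + 1) = P k + b k := by
  -- A signed sum from 0 to `k`: `toNat` empties one of the two sums according to the sign of `k`.
  refine ⟨fun k => ∑ j ∈ Finset.range k.toNat, b j - ∑ j ∈ Finset.range (-k).toNat, b (-j - 1),
    by simp, fun k => ?_⟩
  rcases le_or_gt 0 k with h | h
  · lift k to ℕ using h
    have h1 : ((k : ℤ) + 1).toNat = k + 1 := by omega
    have h2 : (-((k : ℤ) + 1)).toNat = 0 := by omega
    have h3 : (-(k : ℤ)).toNat = 0 := by omega
    simp only [h1, h2, h3, Int.toNat_natCast, Finset.sum_range_succ, Finset.range_zero,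
      Finset.sum_empty, sub_zero]
  · obtain ⟨m, rfl⟩ : ∃ m : ℕ, k = -(m : ℤ) - 1 := ⟨(-k - 1).toNat, by omega⟩
    have h1 : (-(m : ℤ) - 1 + 1).toNat = 0 := by omega
    have h2 : (-(-(m : ℤ) - 1 + 1)).toNat = m := by omega
    have h3 : (-(m : ℤ) - 1).toNat = 0 := by omega
    have h4 : (-(-(m : ℤ) - 1)).toNat = m + 1 := by omega
    simp only [h1, h2, h3, h4, Finset.sum_range_succ, Finset.range_zero, Finset.sum_empty]
    abel

section SSet

universe v w
variable {C : Type u} [Category.{v} C] [HasCoproducts.{w} C] [Preadditive C]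
  {X Y : SSet.{w}} (t : X ⟶ X) (p : X ⟶ Y) (h : t ≫ p = p) (R : C)

/-- The sequence `C(X) --t-1--> C(X) --p--> C(Y)` of simplicial chain complexes attached to an
endomorphism `t` of `X` over `Y`. -/
noncomputable abbrev SSet.translationShortComplex : ShortComplex (ChainComplex C ℕ) :=
  ShortComplex.mk (SSet.chainComplexMap t R - 𝟙 (X.chainComplex R)) (SSet.chainComplexMap p R) (by
    rw [Preadditive.sub_comp, Category.id_comp, SSet.chainComplexMap, SSet.chainComplexMap,
      ← Functor.map_comp, h, sub_self])

/-- If the `n`-simplices of `X` are `ℤ × Yₙ`, with `t` acting as the shift on `ℤ`, then the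
sequence `C(X) --t-1--> C(X) --p--> C(Y)` is split exact in degree `n`. -/
theorem SSet.nonempty_splitting_translationShortComplex (n : ℕ)
    (e : ℤ × Y _⦋n⦌ ≃ X _⦋n⦌) (ht : ∀ k y, t.app _ (e (k, y)) = e (k + 1, y))
    (hp : ∀ k y, p.app _ (e (k, y)) = y) :
    Nonempty ((SSet.translationShortComplex t p h R).map
      (HomologicalComplex.eval C _ n)).Splitting := by
  choose P hP₀ hP₁ using fun y =>
    Int.exists_add_one_eq_add fun k => X.ιChainComplex (R := R) (e (k, y))
  -- The retraction is the discrete primitive `e (k, y) ↦ e (0, y) + … + e (k - 1, y)` (signed for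
  -- negative `k`); the section uses sheet 0.
  let r : (X.chainComplex R).X n ⟶ (X.chainComplex R).X n :=
    Cofan.IsColimit.desc (X.isColimitChainComplexXCofan R n)
      (fun x => P (e.symm x).2 (e.symm x).1)
  let s : (Y.chainComplex R).X n ⟶ (X.chainComplex R).X n :=
    Cofan.IsColimit.desc (Y.isColimitChainComplexXCofan R n)
      (fun y => X.ιChainComplex (e (0, y)))
  have hr : ∀ k y, X.ιChainComplex (e (k, y)) ≫ r = P y k := fun k y =>
    (Cofan.IsColimit.fac (X.isColimitChainComplexXCofan R n) _ (e (k, y))).trans (by simp)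
  have hs : ∀ y, Y.ιChainComplex y ≫ s = X.ιChainComplex (e (0, y)) := fun y =>
    Cofan.IsColimit.fac (Y.isColimitChainComplexXCofan R n) _ y
  have hf : ∀ k y, X.ιChainComplex (e (k, y)) ≫
      (SSet.chainComplexMap t R - 𝟙 (X.chainComplex R)).f n =
      X.ιChainComplex (e (k + 1, y)) - X.ιChainComplex (e (k, y)) := fun k y => by
    rw [HomologicalComplex.sub_f_apply, Preadditive.comp_sub, SSet.ι_chainComplexMap_f, ht,
      HomologicalComplex.id_f, Category.comp_id]
  -- Applying `t - 1` to the primitive telescopes.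
  have hPf : ∀ k y, P y k ≫ (SSet.chainComplexMap t R - 𝟙 (X.chainComplex R)).f n =
      X.ιChainComplex (e (k, y)) - X.ιChainComplex (e (0, y)) := fun k y => by
    induction k using Int.induction_on with
    | zero => rw [hP₀, zero_comp, sub_self]
    | succ k ih => rw [hP₁, Preadditive.add_comp, ih, hf]; abel
    | pred k ih =>
      have h₁ := hP₁ y (-k - 1)
      have h₂ := hf (-k - 1) y
      rw [sub_add_cancel] at h₁ h₂
      rw [h₁, Preadditive.add_comp, h₂] at ih
      rw [eq_sub_of_add_eq ih]
      abel
  refine ⟨⟨r, s, ?_, ?_, ?_⟩⟩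
  · refine SSet.chainComplex_hom_ext fun x => ?_
    obtain ⟨⟨k, y⟩, rfl⟩ := e.surjective x
    change X.ιChainComplex (e (k, y)) ≫
      (SSet.chainComplexMap t R - 𝟙 (X.chainComplex R)).f n ≫ r =
      X.ιChainComplex (e (k, y)) ≫ 𝟙 _
    rw [← Category.assoc, hf, Preadditive.sub_comp, hr, hr, hP₁, add_sub_cancel_left,
      Category.comp_id]
  · refine SSet.chainComplex_hom_ext fun y => ?_
    change Y.ιChainComplex y ≫ s ≫ (SSet.chainComplexMap p R).f n = Y.ιChainComplex y ≫ 𝟙 _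
    rw [← Category.assoc, hs, SSet.ι_chainComplexMap_f, hp, Category.comp_id]
  · refine SSet.chainComplex_hom_ext fun x => ?_
    obtain ⟨⟨k, y⟩, rfl⟩ := e.surjective x
    change X.ιChainComplex (e (k, y)) ≫
      (r ≫ (SSet.chainComplexMap t R - 𝟙 (X.chainComplex R)).f n +
        (SSet.chainComplexMap p R).f n ≫ s) = X.ιChainComplex (e (k, y)) ≫ 𝟙 _
    rw [Preadditive.comp_add, ← Category.assoc, ← Category.assoc, hr, SSet.ι_chainComplexMap_f,
      hp, hs, hPf, sub_add_cancel, Category.comp_id]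

end SSet

/-- Maps from a contractible space to the line are maps to the circle together with an integer. -/
theorem Circle.exists_equiv_continuousMap (A : Type*) [TopologicalSpace A] [ContractibleSpace A] :
    ∃ e : ℤ × C(A, Circle) ≃ C(A, ℝ),
      (∀ k y a, e (k + 1, y) a = e (k, y) a + 2 * Real.pi) ∧
      (∀ k y a, Circle.exp (e (k, y) a) = y a) := by
  choose s hs using fun y : C(A, Circle) =>
    Circle.isCoveringMap_exp.exists_lift_of_contractible Circle.exp_surjective y
  have hp : ∀ (k : ℤ) y a, Circle.exp (s y a + k * (2 * Real.pi)) = y a := fun k y a => by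
    rw [← hs]
    exact Circle.exp_eq_exp.mpr ⟨k, rfl⟩
  have a₀ : A := Classical.arbitrary A
  refine ⟨Equiv.ofBijective (fun ky => s ky.2 + .const A (ky.1 * (2 * Real.pi))) ⟨?_, ?_⟩, ?_, ?_⟩
  · rintro ⟨k, y⟩ ⟨k', y'⟩ h
    obtain rfl : y = y' := by
      ext1 a
      have := congrArg (fun F : C(A, ℝ) => Circle.exp (F a)) h
      simpa [hp] using this
    have : s y a₀ + k * (2 * Real.pi) = s y a₀ + k' * (2 * Real.pi) :=
      congrArg (fun F : C(A, ℝ) => F a₀) h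
    simpa [Real.pi_ne_zero] using this
  · intro F
    let y : C(A, Circle) := .comp ⟨Circle.exp, Circle.exp.continuous⟩ F
    obtain ⟨k, hk⟩ := Circle.exp_eq_exp.mp (show Circle.exp (F a₀) = Circle.exp (s y a₀) by
      rw [hs]; rfl)
    -- Two lifts of the same map from a connected space agree once they agree at `a₀`, and `k` is
    -- chosen to match them there.
    refine ⟨(k, y), ContinuousMap.coe_injective (Circle.isCoveringMap_exp.eq_of_comp_eq
      (ContinuousMap.continuous _) F.continuous (funext fun a => ?_) a₀ ?_)⟩
    · simp [hp, y]
    · simp [hk]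
  · intro k y a
    change s y a + ((k + 1 : ℤ) : ℝ) * (2 * Real.pi) = s y a + k * (2 * Real.pi) + 2 * Real.pi
    push_cast
    ring
  · exact hp

instance stdSimplex.instContractibleSpace (n : ℕ) :
    ContractibleSpace (stdSimplex ℝ (Fin (n + 1))) :=
  (convex_stdSimplex ℝ _).contractibleSpace (Set.Nonempty.of_subtype (s := stdSimplex ℝ _))

/-- Translation by `2π` on the line. -/
noncomputable def lineTranslation : TopCat.of ℝ ⟶ TopCat.of ℝ :=
  TopCat.ofHom ⟨fun x => x + 2 * Real.pi, by fun_prop⟩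

/-- The universal covering of the circle. -/
noncomputable def lineToCircle : TopCat.of ℝ ⟶ TopCat.of Circle :=
  TopCat.ofHom ⟨Circle.exp, Circle.exp.continuous⟩

theorem lineTranslation_lineToCircle : lineTranslation ≫ lineToCircle = lineToCircle :=
  TopCat.hom_ext (ContinuousMap.ext fun x => Circle.periodic_exp x)

theorem toSSet_lineTranslation_lineToCircle :
    TopCat.toSSet.map lineTranslation ≫ TopCat.toSSet.map lineToCircle =
      TopCat.toSSet.map lineToCircle := by
  rw [← Functor.map_comp, lineTranslation_lineToCircle]

variable (K : Type u) [CommRing K]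

/-- Exactness is checked degree by degree, so the splittings need not commute with the
differentials. -/
theorem translationShortComplex_circle_shortExact :
    (SSet.translationShortComplex _ _ toSSet_lineTranslation_lineToCircle
      (ModuleCat.of K K)).ShortExact := by
  refine HomologicalComplex.shortExact_of_degreewise_shortExact _ fun n => ?_
  obtain ⟨e, ht, hp⟩ := Circle.exists_equiv_continuousMap (stdSimplex ℝ (Fin (n + 1)))
  let e₁ := (TopCat.of ℝ).toSSetObjEquiv (.op ⦋n⦌)
  let e₂ := (TopCat.of Circle).toSSetObjEquiv (.op ⦋n⦌)
  refine (SSet.nonempty_splitting_translationShortComplex _ _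
    toSSet_lineTranslation_lineToCircle (ModuleCat.of K K) n
    (((Equiv.refl ℤ).prodCongr e₂).trans (e.trans e₁.symm)) (fun k y => ?_) (fun k y => ?_)).elim
    fun σ => σ.shortExact
  · refine e₁.injective (ContinuousMap.ext fun a => ?_)
    exact (ht k (e₂ y) a).symm
  · refine e₂.injective (ContinuousMap.ext fun a => ?_)
    exact hp k (e₂ y) a

/-- The singular homology of the line in positive degrees. -/
theorem isZero_singularHomology_line (n : ℕ) (hn : n ≠ 0) :
    IsZero (((singularHomologyFunctor (ModuleCat.{u} K) n).obj
      (ModuleCat.of K K)).obj (TopCat.of ℝ)) := by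
  let i : TopCat.of PUnit.{1} ⟶ TopCat.of ℝ := TopCat.ofHom (.const _ 0)
  let q : TopCat.of ℝ ⟶ TopCat.of PUnit.{1} := TopCat.ofHom (.const _ PUnit.unit)
  -- Scaling contracts the line to 0, so its identity factors on homology through that of a point.
  have H : TopCat.Homotopy (q ≫ i) (𝟙 _) :=
    { toFun := fun x => x.1 * x.2
      continuous_toFun := by fun_prop
      map_zero_left := fun x => by simp [q, i]
      map_one_left := fun x => by simp }
  have h₁ := H.congr_homologyMap_singularChainComplexFunctor (ModuleCat.of K K) n
  have h₂ := isZero_singularHomologyFunctor_of_totallyDisconnectedSpace (ModuleCat.{u} K) n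
    (ModuleCat.of K K) (TopCat.of PUnit.{1}) hn
  rw [Functor.map_comp, HomologicalComplex.homologyMap_comp, CategoryTheory.Functor.map_id,
    HomologicalComplex.homologyMap_id] at h₁
  refine (IsZero.iff_id_eq_zero _).mpr (h₁.symm.trans ?_)
  exact (congrArg (· ≫ _) (h₂.eq_of_tgt _ 0)).trans zero_comp

/-- Translation slides back to the identity. This makes the connecting map surjective. -/
theorem homologyMap_lineTranslation_sub_id (n : ℕ) :
    HomologicalComplex.homologyMap (SSet.translationShortComplex _ _
      toSSet_lineTranslation_lineToCircle (ModuleCat.of K K)).f n = 0 := by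
  have H : TopCat.Homotopy lineTranslation (𝟙 _) :=
    { toFun := fun x => x.2 + (1 - x.1) * (2 * Real.pi)
      continuous_toFun := by fun_prop
      map_zero_left := fun x => by simp [lineTranslation]
      map_one_left := fun x => by simp }
  have h₁ := H.congr_homologyMap_singularChainComplexFunctor (ModuleCat.of K K) n
  rw [CategoryTheory.Functor.map_id] at h₁
  rw [HomologicalComplex.homologyMap_sub]
  exact sub_eq_zero.mpr h₁

theorem nonempty_singularHomology_circle_zero_iso :
    Nonempty (((singularHomologyFunctor (ModuleCat.{u} K) 0).obj
      (ModuleCat.of K K)).obj (TopCat.of Circle) ≅ ModuleCat.of K K) :=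
  have : PathConnectedSpace (TopCat.of Circle) := inferInstanceAs (PathConnectedSpace Circle)
  ⟨asIso (TopCat.singularHomology₀ε (TopCat.of Circle) (ModuleCat.of K K))⟩

/-- The connecting map `H₁(S¹) → H₀(ℝ)` is mono because `H₁(ℝ) = 0`, and epi because `t - 1` is zero
on `H₀`. -/
theorem nonempty_singularHomology_circle_one_iso :
    Nonempty (((singularHomologyFunctor (ModuleCat.{u} K) 1).obj
      (ModuleCat.of K K)).obj (TopCat.of Circle) ≅ ModuleCat.of K K) := by
  have : PathConnectedSpace (TopCat.of ℝ) := inferInstanceAs (PathConnectedSpace ℝ)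
  have hS := translationShortComplex_circle_shortExact K
  have h₁ : Mono (hS.δ 1 0 (by simp)) :=
    hS.mono_δ 1 0 (by simp) (isZero_singularHomology_line K 1 one_ne_zero)
  have h₂ : Epi (hS.δ 1 0 (by simp)) := (hS.homology_exact₁ 1 0 (by simp)).epi_f
    (homologyMap_lineTranslation_sub_id K 0)
  have h₃ : IsIso (hS.δ 1 0 (by simp)) := isIso_of_mono_of_epi _
  have h₄ : IsIso (TopCat.singularHomology₀ε (TopCat.of ℝ) (ModuleCat.of K K)) := inferInstance
  exact ⟨(@asIso _ _ _ _ _ h₃).trans (@asIso _ _ _ _ _ h₄)⟩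

theorem isZero_singularHomology_circle (n : ℕ) :
    IsZero (((singularHomologyFunctor (ModuleCat.{u} K) (n + 2)).obj
      (ModuleCat.of K K)).obj (TopCat.of Circle)) := by
  have hS := translationShortComplex_circle_shortExact K
  exact (hS.homology_exact₃ (n + 2) (n + 1) (by simp)).isZero_of_both_zeros
    ((isZero_singularHomology_line K (n + 2) (by omega)).eq_of_src _ _)
    ((isZero_singularHomology_line K (n + 1) (by omega)).eq_of_tgt _ _)

end Singular

/-! ### Cancellation of signs in the prism operator. -/

noncomputable section

/-- The alternating sum identity behind the prism operator. -/
theorem sum_range_prism_eq {M : Type*} [AddCommGroup M] (N : ℕ) (T U : ℕ → ℕ → M)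
    (h₁ : ∀ i < N, T (i + 1) i = T (i + 1) (i + 1))
    (h₂ : ∀ i < N, ∀ j < i + 1, T j (i + 1) = U j i)
    (h₃ : ∀ i < N, ∀ j < N + 1, i < j → T (j + 1) i = U j i) :
    (∑ i ∈ Finset.range (N + 1), ∑ j ∈ Finset.range (N + 2), (-1 : ℤ) ^ (i + j) • T j i) +
      ∑ i ∈ Finset.range N, ∑ j ∈ Finset.range (N + 1), (-1 : ℤ) ^ (i + j) • U j i =
      T 0 0 - T (N + 1) N := by
  -- Each row splits into the entries below the diagonal, the two adjacent entries `j = i` and `j =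
  -- i + 1`, and the entries above, reindexed to match `U`.
  have hT : ∀ i ∈ Finset.range (N + 1),
      ∑ j ∈ Finset.range (N + 2), (-1 : ℤ) ^ (i + j) • T j i =
      ∑ j ∈ Finset.range i, (-1 : ℤ) ^ (i + j) • T j i + (T i i - T (i + 1) i) +
        ∑ j ∈ Finset.Ico (i + 1) (N + 1), (-1 : ℤ) ^ (i + (j + 1)) • T (j + 1) i := fun i hi => by
    have hi := Finset.mem_range.mp hi
    rw [← Finset.sum_range_add_sum_Ico _ (show i + 2 ≤ N + 2 by omega), Finset.sum_range_succ,
      Finset.sum_range_succ, ← Finset.sum_Ico_add' (fun j => (-1 : ℤ) ^ (i + j) • T j i)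
        (i + 1) (N + 1) 1, ← two_mul, ← add_assoc, ← two_mul, pow_succ, pow_mul]
    simp
    abel
  have hU : ∀ i ∈ Finset.range N,
      ∑ j ∈ Finset.range (N + 1), (-1 : ℤ) ^ (i + j) • U j i =
      - (∑ j ∈ Finset.range (i + 1), (-1 : ℤ) ^ (i + 1 + j) • T j (i + 1)) -
        ∑ j ∈ Finset.Ico (i + 1) (N + 1), (-1 : ℤ) ^ (i + (j + 1)) • T (j + 1) i := fun i hi => by
    have hi := Finset.mem_range.mp hi
    rw [← Finset.sum_range_add_sum_Ico _ (show i + 1 ≤ N + 1 by omega), sub_eq_add_neg,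
      ← Finset.sum_neg_distrib, ← Finset.sum_neg_distrib]
    refine congrArg₂ _ (Finset.sum_congr rfl fun j hj => ?_) (Finset.sum_congr rfl fun j hj => ?_)
    · rw [h₂ i hi j (Finset.mem_range.mp hj), ← neg_smul]
      congr 1
      ring
    · have hj := Finset.mem_Ico.mp hj
      rw [h₃ i hi j hj.2 hj.1, ← neg_smul]
      congr 1
      ring
  -- The off-diagonal parts cancel against `U`; the diagonal pairs telescope by `h₁`.
  have hD : ∀ m ≤ N, ∑ i ∈ Finset.range (m + 1), (T i i - T (i + 1) i) = T 0 0 - T (m + 1) m := by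
    intro m hm
    induction m with
    | zero => simp
    | succ m ih => rw [Finset.sum_range_succ, ih (by omega), h₁ m (by omega)]; abel
  rw [Finset.sum_congr rfl hT, Finset.sum_congr rfl hU, Finset.sum_add_distrib,
    Finset.sum_add_distrib, hD N le_rfl, Finset.sum_sub_distrib, Finset.sum_neg_distrib,
    Finset.sum_range_succ' (fun i => ∑ j ∈ Finset.range i, (-1 : ℤ) ^ (i + j) • T j i),
    Finset.sum_range_succ (fun i => ∑ j ∈ Finset.Ico (i + 1) (N + 1), _)]
  simp

/-- The alternating sum identity behind the prism operator, over `Fin`. -/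
theorem sum_prism_eq {M : Type*} [AddCommGroup M] (n : ℕ)
    (T : Fin (n + 3) → Fin (n + 2) → M) (U : Fin (n + 2) → Fin (n + 1) → M)
    (h₁ : ∀ (i : Fin (n + 1)), T i.castSucc.succ i.castSucc = T i.castSucc.succ i.succ)
    (h₂ : ∀ (i : Fin (n + 1)) (j : Fin (n + 2)), j ≤ i.castSucc → T j.castSucc i.succ = U j i)
    (h₃ : ∀ (i : Fin (n + 1)) (j : Fin (n + 2)), i.castSucc < j → T j.succ i.castSucc = U j i) :
    (∑ i : Fin (n + 2), ∑ j : Fin (n + 3), (-1 : ℤ) ^ ((i : ℕ) + j) • T j i) +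
      ∑ j : Fin (n + 2), ∑ i : Fin (n + 1), (-1 : ℤ) ^ ((i : ℕ) + j) • U j i =
      T 0 0 - T (Fin.last _) (Fin.last _) := by
  have key := sum_range_prism_eq (n + 1)
    (fun j i => if h : j < n + 3 ∧ i < n + 2 then T ⟨j, h.1⟩ ⟨i, h.2⟩ else 0)
    (fun j i => if h : j < n + 2 ∧ i < n + 1 then U ⟨j, h.1⟩ ⟨i, h.2⟩ else 0)
    (fun i hi => by
      rw [dif_pos (by omega), dif_pos (by omega)]
      exact h₁ ⟨i, hi⟩)
    (fun i hi j hj => by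
      rw [dif_pos (by omega), dif_pos (by omega)]
      exact h₂ ⟨i, hi⟩ ⟨j, by omega⟩ (Fin.mk_le_mk.mpr (Nat.lt_succ_iff.mp hj)))
    (fun i hi j hj hij => by
      rw [dif_pos (by omega), dif_pos (by omega)]
      exact h₃ ⟨i, hi⟩ ⟨j, hj⟩ (Fin.mk_lt_mk.mpr hij))
  simp only [Finset.sum_range] at key
  rw [Finset.sum_comm (s := (Finset.univ : Finset (Fin (n + 2))))
    (t := (Finset.univ : Finset (Fin (n + 1))))]
  convert key using 3 with i hi i hi
  · refine Finset.sum_congr rfl fun j _ => ?_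
    rw [dif_pos ⟨j.2, i.2⟩]
  · refine Finset.sum_congr rfl fun j _ => ?_
    rw [dif_pos ⟨j.2, i.2⟩]
  · rw [dif_pos (by omega)]
    rfl
  · rw [dif_pos (by omega)]
    rfl

/-! ### Step-preserving maps and prisms of sequences. -/

namespace PathHomology

section Functoriality

variable {V : Type} {X : Digraph V}

variable (X) in
/-- A map of vertices that sends steps to steps. -/
def IsStepHom (f : V → V) : Prop := ∀ ⦃x y⦄, Step X x y → Step X (f x) (f y)

theorem Step.reach {x y : V} (h : Step X x y) : Reach X x y := Relation.ReflTransGen.single h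

theorem IsPath.isAccessible {n : ℕ} {x : Fin (n + 1) → V} (hx : IsPath X x) : IsAccessible X x :=
  fun i => (hx i).reach

theorem IsStepHom.reach {f : V → V} (hf : IsStepHom X f) {x y : V} (h : Reach X x y) :
    Reach X (f x) (f y) :=
  Relation.ReflTransGen.lift f (fun _ _ h => hf h) _ _ h

/-- The image of an accessible sequence. -/
def AccSeq.map {f : V → V} (hf : IsStepHom X f) {n : ℕ} (x : AccSeq X n) : AccSeq X n :=
  ⟨f ∘ x.1, fun i => hf.reach (x.2 i)⟩

/-- The sequence `(f x₀, …, f xᵢ, g xᵢ, …, g xₙ)`. -/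
def prismSeq (f g : V → V) {n : ℕ} (i : Fin (n + 1)) (x : Fin (n + 1) → V) : Fin (n + 2) → V :=
  fun k => if k ≤ i.castSucc then f (x (i.predAbove k)) else g (x (i.predAbove k))

theorem prismSeq_of_le (f g : V → V) {n : ℕ} {i : Fin (n + 1)} (x : Fin (n + 1) → V)
    {k : Fin (n + 2)} {m : Fin (n + 1)} (h : (k : ℕ) ≤ i) (hm : (m : ℕ) = k) :
    prismSeq f g i x k = f (x m) := by
  have h₁ : k ≤ i.castSucc := h
  have h₂ : i.predAbove k = m := by
    rw [Fin.predAbove_of_le_castSucc _ _ h₁]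
    exact Fin.ext hm.symm
  rw [prismSeq, if_pos h₁, h₂]

theorem prismSeq_of_lt (f g : V → V) {n : ℕ} {i : Fin (n + 1)} (x : Fin (n + 1) → V)
    {k : Fin (n + 2)} {m : Fin (n + 1)} (h : (i : ℕ) < k) (hm : (m : ℕ) + 1 = k) :
    prismSeq f g i x k = g (x m) := by
  have h₁ : i.castSucc < k := h
  have h₂ : i.predAbove k = m := by
    rw [Fin.predAbove_of_castSucc_lt _ _ h₁]
    refine Fin.ext ?_
    rw [Fin.val_pred]
    omega
  rw [prismSeq, if_neg h₁.not_ge, h₂]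

/-- Stated for arbitrary relations so as to serve both `Reach` (accessible sequences) and `Step`
(paths). -/
theorem prismSeq_rel {f g : V → V} {r s : V → V → Prop} (hf : ∀ x y, r x y → s (f x) (f y))
    (hg : ∀ x y, r x y → s (g x) (g y)) (hfg : ∀ x, s (f x) (g x)) {n : ℕ} (i : Fin (n + 1))
    {x : Fin (n + 1) → V} (hx : ∀ k : Fin n, r (x k.castSucc) (x k.succ)) (k : Fin (n + 1)) :
    s (prismSeq f g i x k.castSucc) (prismSeq f g i x k.succ) := by
  have hk := k.2
  have hi := i.2
  rcases lt_trichotomy (k : ℕ) i with h | h | h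
  · rw [prismSeq_of_le f g x (m := (⟨k, by omega⟩ : Fin n).castSucc) h.le rfl,
      prismSeq_of_le f g x (m := (⟨k, by omega⟩ : Fin n).succ) (by simp; omega) rfl]
    exact hf _ _ (hx _)
  · rw [prismSeq_of_le f g x (m := k) h.le rfl,
      prismSeq_of_lt f g x (m := k) (by simp [h]) rfl]
    exact hfg _
  · rw [prismSeq_of_lt f g x (m := (⟨k - 1, by omega⟩ : Fin n).castSucc) h (by simp; omega),
      prismSeq_of_lt f g x (m := (⟨k - 1, by omega⟩ : Fin n).succ) (by simp; omega)
        (by simp; omega)]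
    exact hg _ _ (hx _)

theorem prismSeq_not_isRegular (f g : V → V) {n : ℕ} (i : Fin (n + 1)) {x : Fin (n + 1) → V}
    (hx : ¬ IsRegular x) : ¬ IsRegular (prismSeq f g i x) := by
  obtain ⟨k, hk⟩ : ∃ k : Fin n, x k.castSucc = x k.succ := by simpa [IsRegular] using hx
  intro h
  rcases lt_or_ge (k : ℕ) i with hki | hki
  · refine h k.castSucc ?_
    rw [prismSeq_of_le f g x (m := k.castSucc) hki.le rfl,
      prismSeq_of_le f g x (m := k.succ) (by simp; omega) rfl, hk]
  · refine h k.succ ?_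
    rw [prismSeq_of_lt f g x (m := k.castSucc) (by simp; omega) rfl,
      prismSeq_of_lt f g x (m := k.succ) (by simp; omega) rfl, hk]

/-- The accessible sequence `(f x₀, …, f xᵢ, g xᵢ, …, g xₙ)`. -/
def AccSeq.prism {f g : V → V} (hf : IsStepHom X f) (hg : IsStepHom X g)
    (hfg : ∀ x, Step X (f x) (g x)) {n : ℕ} (i : Fin (n + 1)) (x : AccSeq X n) :
    AccSeq X (n + 1) :=
  ⟨prismSeq f g i x.1, prismSeq_rel (r := Reach X) (s := Reach X) (fun _ _ => hf.reach)
    (fun _ _ => hg.reach) (fun x => (hfg x).reach) i x.2⟩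

section Faces

variable {f g : V → V} (hf : IsStepHom X f) (hg : IsStepHom X g) (hfg : ∀ x, Step X (f x) (g x))

theorem AccSeq.face_map {n : ℕ} (x : AccSeq X (n + 1)) (i : Fin (n + 2)) :
    (x.map hf).face i = (x.face i).map hf := rfl

theorem AccSeq.face_zero_prism_zero {n : ℕ} (x : AccSeq X n) :
    (x.prism hf hg hfg 0).face 0 = x.map hg :=
  Subtype.ext (funext fun k => prismSeq_of_lt f g x.1 (i := 0) (k := (0 : Fin (n + 2)).succAbove k)
    (m := k) (by simp) (by simp))

theorem AccSeq.face_last_prism_last {n : ℕ} (x : AccSeq X n) :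
    (x.prism hf hg hfg (Fin.last n)).face (Fin.last (n + 1)) = x.map hf :=
  Subtype.ext (funext fun k => prismSeq_of_le f g x.1 (m := k)
    (by simp; omega) (by simp))

theorem _root_.Fin.val_succAbove_eq_ite {n : ℕ} (j : Fin (n + 1)) (k : Fin n) :
    (j.succAbove k : ℕ) = if (k : ℕ) < j then (k : ℕ) else k + 1 := by
  simp only [Fin.succAbove, Fin.lt_def]
  split_ifs <;> simp_all

/-- Adjacent prisms share a face: omitting `g xᵢ` from one or `f xᵢ₊₁` from the next leaves the same
sequence. -/
theorem AccSeq.face_succ_prism {n : ℕ} (x : AccSeq X (n + 1)) (i : Fin (n + 1)) :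
    (x.prism hf hg hfg i.castSucc).face i.castSucc.succ =
      (x.prism hf hg hfg i.succ).face i.castSucc.succ := by
  refine Subtype.ext (funext fun k => ?_)
  simp only [face, prism]
  have hv := Fin.val_succAbove_eq_ite i.castSucc.succ k
  simp only [Fin.val_succ, Fin.val_castSucc] at hv
  rcases lt_or_ge (k : ℕ) (i + 1) with h | h
  · rw [if_pos h] at hv
    rw [prismSeq_of_le f g x.1 (m := k) (by simp; omega) hv.symm,
      prismSeq_of_le f g x.1 (m := k) (by simp; omega) hv.symm]
  · rw [if_neg h.not_gt] at hv
    rw [prismSeq_of_lt f g x.1 (m := k) (by simp; omega) hv.symm,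
      prismSeq_of_lt f g x.1 (m := k) (by simp; omega) hv.symm]

/-- The omitted entry `f xⱼ` lies in the `f` block, so the turning point moves down by one. -/
theorem AccSeq.face_prism_of_le {n : ℕ} (x : AccSeq X (n + 1)) {i : Fin (n + 1)} {j : Fin (n + 2)}
    (hij : j ≤ i.castSucc) :
    (x.prism hf hg hfg i.succ).face j.castSucc = (x.face j).prism hf hg hfg i := by
  refine Subtype.ext (funext fun k => ?_)
  simp only [face, prism]
  have hv := Fin.val_succAbove_eq_ite j.castSucc k
  have hij' : (j : ℕ) ≤ i := hij
  simp only [Fin.val_castSucc] at hv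
  have hk := k.2
  have hi := i.2
  rcases lt_or_ge (i : ℕ) k with h | h
  · have hw := Fin.val_succAbove_eq_ite j ⟨k - 1, by omega⟩
    rw [if_neg (by omega)] at hv
    rw [if_neg (by simp; omega)] at hw
    rw [prismSeq_of_lt f g x.1 (m := j.succAbove ⟨k - 1, by omega⟩) (by simp; omega)
      (by simp at hw; omega), prismSeq_of_lt f g _ (m := ⟨k - 1, by omega⟩) h (by simp; omega)]
  · have hw := Fin.val_succAbove_eq_ite j ⟨k, by omega⟩
    rw [prismSeq_of_le f g x.1 (m := j.succAbove ⟨k, by omega⟩)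
      (by rw [hv]; split_ifs <;> simp <;> omega) (by rw [hw, hv]), prismSeq_of_le f g _ (m := ⟨k, by omega⟩) h rfl]

/-- The omitted entry `g xⱼ` lies in the `g` block, after the turning point. -/
theorem AccSeq.face_prism_of_lt {n : ℕ} (x : AccSeq X (n + 1)) {i : Fin (n + 1)} {j : Fin (n + 2)}
    (hij : i.castSucc < j) :
    (x.prism hf hg hfg i.castSucc).face j.succ = (x.face j).prism hf hg hfg i := by
  refine Subtype.ext (funext fun k => ?_)
  simp only [face, prism]
  have hv := Fin.val_succAbove_eq_ite j.succ k
  have hij' : (i : ℕ) < j := hij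
  simp only [Fin.val_succ] at hv
  have hk := k.2
  have hi := i.2
  rcases lt_or_ge (i : ℕ) k with h | h
  · have hw := Fin.val_succAbove_eq_ite j ⟨k - 1, by omega⟩
    rw [prismSeq_of_lt f g x.1 (m := j.succAbove ⟨k - 1, by omega⟩)
      (by rw [hv]; split_ifs <;> simp <;> omega)
      (by rw [hw, hv]; simp only; split_ifs <;> omega),
      prismSeq_of_lt f g _ (m := ⟨k - 1, by omega⟩) h (by simp; omega)]
  · have hw := Fin.val_succAbove_eq_ite j ⟨k, by omega⟩
    rw [if_pos (by omega)] at hv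
    rw [if_pos (by simp; omega)] at hw
    rw [prismSeq_of_le f g x.1 (m := j.succAbove ⟨k, by omega⟩) (by simp; omega)
      (by rw [hw, hv]), prismSeq_of_le f g _ (m := ⟨k, by omega⟩) h rfl]

end Faces

end Functoriality

/-! ### Induced chain maps and prism homotopies on path chains. -/

section Linear

variable (K : Type u) [CommRing K] {V : Type} {X : Digraph V} {f g : V → V}
  (hf : IsStepHom X f) (hg : IsStepHom X g) (hfg : ∀ x, Step X (f x) (g x))

variable (X) in
/-- The class of an accessible sequence in `𝓡ₙ(X)`. -/
def cls {n : ℕ} (x : AccSeq X n) : Reg K X n := (degenerate K X n).mkQ (Finsupp.single x 1)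

variable {K}

theorem regD_cls {n : ℕ} (x : AccSeq X (n + 1)) :
    regD K X n (cls K X x) = ∑ i : Fin (n + 2), (-1 : K) ^ (i : ℕ) • cls K X (x.face i) := by
  simp only [cls, regD, Submodule.mkQ_apply, Submodule.mapQ_apply, lamD_single]
  simp only [← Submodule.mkQ_apply, map_sum, map_smul]

theorem cls_eq_zero {n : ℕ} {x : AccSeq X n} (hx : ¬ IsRegular x.1) : cls K X x = 0 := by
  rw [cls, Submodule.mkQ_apply, Submodule.Quotient.mk_eq_zero]
  exact Submodule.subset_span ⟨x, hx, rfl⟩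

theorem reg_hom_ext {M : Type*} [AddCommGroup M] [Module K M] {n : ℕ} {φ ψ : Reg K X n →ₗ[K] M}
    (h : ∀ x, φ (cls K X x) = ψ (cls K X x)) : φ = ψ := by
  refine Submodule.linearMap_qext _ (Finsupp.lhom_ext' fun x => LinearMap.ext_ring ?_)
  exact h x

theorem degenerate_le_ker {M : Type*} [AddCommGroup M] [Module K M] {n : ℕ} (φ : AccSeq X n → M)
    (h : ∀ x, ¬ IsRegular x.1 → φ x = 0) :
    degenerate K X n ≤ LinearMap.ker (Finsupp.linearCombination K φ) :=
  Submodule.span_le.mpr (by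
    rintro _ ⟨x, hx, rfl⟩
    simpa using h x hx)

variable (X) in
/-- The linear map on `𝓡ₙ(X)` with prescribed values, vanishing on irregular sequences, on
accessible sequences. -/
def regLift {M : Type*} [AddCommGroup M] [Module K M] {n : ℕ} (φ : AccSeq X n → M)
    (h : ∀ x, ¬ IsRegular x.1 → φ x = 0) : Reg K X n →ₗ[K] M :=
  (degenerate K X n).liftQ (Finsupp.linearCombination K φ) (degenerate_le_ker φ h)

theorem regLift_cls {M : Type*} [AddCommGroup M] [Module K M] {n : ℕ} (φ : AccSeq X n → M)
    (h : ∀ x, ¬ IsRegular x.1 → φ x = 0) (x : AccSeq X n) :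
    regLift X φ h (cls K X x) = φ x := by
  simp [regLift, cls]

theorem allowed_induction {n : ℕ} {p : Reg K X n → Prop} {a : Reg K X n}
    (ha : a ∈ allowed K X n) (h₀ : p 0) (hadd : ∀ a b, p a → p b → p (a + b))
    (hsmul : ∀ (c : K) a, p a → p (c • a)) (hcls : ∀ x : AccSeq X n, IsPath X x.1 → p (cls K X x)) :
    p a := by
  induction ha using Submodule.span_induction with
  | mem _ h => obtain ⟨x, hx, rfl⟩ := h; exact hcls x hx
  | zero => exact h₀
  | add _ _ _ _ h₁ h₂ => exact hadd _ _ h₁ h₂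
  | smul c _ _ h => exact hsmul c _ h

theorem map_allowed_le {m n : ℕ} (φ : Reg K X m →ₗ[K] Reg K X n)
    (h : ∀ x : AccSeq X m, IsPath X x.1 → φ (cls K X x) ∈ allowed K X n) {a : Reg K X m}
    (ha : a ∈ allowed K X m) : φ a ∈ allowed K X n :=
  allowed_induction (p := fun a => φ a ∈ allowed K X n) ha (by simp)
    (fun a b ha hb => by rw [map_add]; exact add_mem ha hb)
    (fun c a ha => by rw [map_smul]; exact Submodule.smul_mem _ _ ha) h

theorem mem_Omega_succ {n : ℕ} {a : Reg K X (n + 1)} :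
    a ∈ Omega K X (n + 1) ↔ a ∈ allowed K X (n + 1) ∧ regD K X n a ∈ allowed K X n := Iff.rfl

theorem cls_mem_allowed {n : ℕ} {x : AccSeq X n} (hx : IsPath X x.1) :
    cls K X x ∈ allowed K X n := Submodule.subset_span ⟨x, hx, rfl⟩

variable (K)

/-- The map induced by `f` on `𝓡ₙ(X)`. -/
def regMap (n : ℕ) : Reg K X n →ₗ[K] Reg K X n :=
  regLift X (fun x => cls K X (x.map hf)) fun _ hx => cls_eq_zero fun h => hx fun i hi =>
    h i (congrArg f hi)

/-- The prism operator on `𝓡(X)`. -/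
def regPrism (n : ℕ) : Reg K X n →ₗ[K] Reg K X (n + 1) :=
  regLift X (fun x => ∑ i : Fin (n + 1), (-1 : K) ^ (i : ℕ) • cls K X (x.prism hf hg hfg i))
    fun x hx => Finset.sum_eq_zero fun i _ => by
      rw [cls_eq_zero (prismSeq_not_isRegular f g i hx), smul_zero]

variable {K}

theorem regMap_cls {n : ℕ} (x : AccSeq X n) : regMap K hf n (cls K X x) = cls K X (x.map hf) :=
  regLift_cls _ _ _

theorem regPrism_cls {n : ℕ} (x : AccSeq X n) : regPrism K hf hg hfg n (cls K X x) =
    ∑ i : Fin (n + 1), (-1 : K) ^ (i : ℕ) • cls K X (x.prism hf hg hfg i) :=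
  regLift_cls _ _ _

theorem regD_regMap {n : ℕ} (a : Reg K X (n + 1)) :
    regD K X n (regMap K hf (n + 1) a) = regMap K hf n (regD K X n a) := by
  refine LinearMap.congr_fun (f := regD K X n ∘ₗ regMap K hf (n + 1))
    (g := regMap K hf n ∘ₗ regD K X n) (reg_hom_ext fun x => ?_) a
  simp only [LinearMap.comp_apply, regMap_cls, regD_cls, map_sum, map_smul, AccSeq.face_map]

theorem regMap_mem_allowed {n : ℕ} {a : Reg K X n} (ha : a ∈ allowed K X n) :
    regMap K hf n a ∈ allowed K X n :=
  map_allowed_le _ (fun _ hx => by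
    rw [regMap_cls]
    exact cls_mem_allowed fun i => hf (hx i)) ha

theorem regMap_mem_Omega {n : ℕ} {a : Reg K X n} (ha : a ∈ Omega K X n) :
    regMap K hf n a ∈ Omega K X n := by
  cases n with
  | zero => exact regMap_mem_allowed hf ha
  | succ n =>
    refine mem_Omega_succ.mpr ⟨regMap_mem_allowed hf ha.1, ?_⟩
    rw [regD_regMap]
    exact regMap_mem_allowed hf ha.2

theorem regPrism_mem_allowed {n : ℕ} {a : Reg K X n} (ha : a ∈ allowed K X n) :
    regPrism K hf hg hfg n a ∈ allowed K X (n + 1) :=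
  map_allowed_le _ (fun x hx => by
    rw [regPrism_cls]
    exact Submodule.sum_mem _ fun i _ => Submodule.smul_mem _ _ (cls_mem_allowed
      (prismSeq_rel (r := Step X) (s := Step X) (fun _ _ => @hf _ _) (fun _ _ => @hg _ _)
        hfg i hx))) ha

theorem regD_regPrism_zero (a : Reg K X 0) :
    regD K X 0 (regPrism K hf hg hfg 0 a) = regMap K hg 0 a - regMap K hf 0 a := by
  refine LinearMap.congr_fun (f := regD K X 0 ∘ₗ regPrism K hf hg hfg 0)
    (g := regMap K hg 0 - regMap K hf 0) (reg_hom_ext fun x => ?_) a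
  simp only [LinearMap.comp_apply, LinearMap.sub_apply, regMap_cls, regPrism_cls, regD_cls,
    Fin.sum_univ_succ, map_add, map_smul]
  have h₁ := AccSeq.face_zero_prism_zero hf hg hfg x
  have h₂ := AccSeq.face_last_prism_last hf hg hfg x
  simp at h₂ ⊢
  simp [h₁, h₂, sub_eq_add_neg]

/-- On generators this is `sum_prism_eq`, with `T` the faces of prisms and `U` the prisms of faces.
-/
theorem regD_regPrism_succ {n : ℕ} (a : Reg K X (n + 1)) :
    regD K X (n + 1) (regPrism K hf hg hfg (n + 1) a) +
      regPrism K hf hg hfg n (regD K X n a) =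
      regMap K hg (n + 1) a - regMap K hf (n + 1) a := by
  refine LinearMap.congr_fun (f := regD K X (n + 1) ∘ₗ regPrism K hf hg hfg (n + 1) +
    regPrism K hf hg hfg n ∘ₗ regD K X n) (g := regMap K hg (n + 1) - regMap K hf (n + 1))
    (reg_hom_ext fun x => ?_) a
  have key := sum_prism_eq n (fun j i => cls K X ((x.prism hf hg hfg i).face j))
    (fun j i => cls K X ((x.face j).prism hf hg hfg i))
    (fun i => by rw [AccSeq.face_succ_prism])
    (fun i j h => by rw [AccSeq.face_prism_of_le _ _ _ _ h])
    (fun i j h => by rw [AccSeq.face_prism_of_lt _ _ _ _ h])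
  simp only [AccSeq.face_zero_prism_zero, AccSeq.face_last_prism_last] at key
  simp only [LinearMap.add_apply, LinearMap.comp_apply, LinearMap.sub_apply, regMap_cls,
    regPrism_cls, regD_cls, map_sum, map_smul, Finset.smul_sum, smul_smul]
  rw [← key]
  congr 1 <;> refine Finset.sum_congr rfl fun i _ => Finset.sum_congr rfl fun j _ => ?_
  · rw [← Int.cast_smul_eq_zsmul K, pow_add]
    simp
  · rw [← Int.cast_smul_eq_zsmul K, pow_add, mul_comm]
    simp

/-- The homotopy formula writes the boundary of the prism in terms of `a` and `∂a`, both spanned by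
paths. -/
theorem regPrism_mem_Omega {n : ℕ} {a : Reg K X n} (ha : a ∈ Omega K X n) :
    regPrism K hf hg hfg n a ∈ Omega K X (n + 1) := by
  cases n with
  | zero =>
    refine mem_Omega_succ.mpr ⟨regPrism_mem_allowed hf hg hfg ha, ?_⟩
    rw [regD_regPrism_zero]
    exact sub_mem (regMap_mem_allowed hg ha) (regMap_mem_allowed hf ha)
  | succ n =>
    refine mem_Omega_succ.mpr ⟨regPrism_mem_allowed hf hg hfg ha.1, ?_⟩
    rw [eq_sub_of_add_eq (regD_regPrism_succ hf hg hfg a)]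
    exact sub_mem (sub_mem (regMap_mem_allowed hg ha.1) (regMap_mem_allowed hf ha.1))
      (regPrism_mem_allowed hf hg hfg ha.2)

end Linear

end PathHomology

end

noncomputable section

namespace PathHomology

/-! ### Dyadic roots of unity and the floor maps. -/

section Dyadic

/-- The point `e^{2πi m / 2ᴺ}`. -/
def dyadicPoint (m : ℤ) (N : ℕ) : dyadicCircle :=
  ⟨Circle.exp (2 * Real.pi * (m / 2 ^ N)), 4 * m, N + 1, by omega, by
    congr 1
    push_cast
    field_simp
    ring⟩

theorem dyadicPoint_eq_iff {m m' : ℤ} {N : ℕ} :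
    dyadicPoint m N = dyadicPoint m' N ↔ (2 ^ N : ℤ) ∣ m - m' := by
  have hpi := Real.pi_ne_zero
  rw [Subtype.ext_iff, dyadicPoint, dyadicPoint, Circle.exp_eq_exp]
  refine exists_congr fun k => ?_
  rw [← @Int.cast_inj ℝ]
  push_cast
  constructor
  · intro h
    field_simp at h
    linarith
  · intro h
    rw [eq_add_of_sub_eq h]
    field_simp
    ring

theorem dyadicPoint_add (m m' : ℤ) (N : ℕ) :
    dyadicPoint (m + m') N = dyadicPoint m N * dyadicPoint m' N := by
  refine Subtype.ext ?_
  simp only [dyadicPoint, Subgroup.coe_mul, ← Circle.exp_add]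
  congr 1
  push_cast
  ring

theorem dyadicPoint_mul_two_pow (m : ℤ) (N k : ℕ) :
    dyadicPoint (m * 2 ^ k) (N + k) = dyadicPoint m N := by
  refine Subtype.ext ?_
  simp only [dyadicPoint]
  congr 2
  push_cast
  rw [pow_add, mul_div_mul_right _ _ (by positivity)]

theorem dyadicPoint_of_le (m : ℤ) {M N : ℕ} (h : M ≤ N) :
    dyadicPoint m M = dyadicPoint (m * 2 ^ (N - M)) N := by
  obtain ⟨k, rfl⟩ := Nat.exists_eq_add_of_le h
  rw [Nat.add_sub_cancel_left, dyadicPoint_mul_two_pow]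

theorem exists_eq_dyadicPoint (z : dyadicCircle) :
    ∃ M, ∀ N, M ≤ N → ∃ m : ℤ, z = dyadicPoint m N := by
  obtain ⟨z, m, n, hn, rfl⟩ := z
  refine ⟨n + 1, fun N hN => ⟨m * 2 ^ (N - (n + 1)), ?_⟩⟩
  rw [← dyadicPoint_of_le m hN]
  refine Subtype.ext ?_
  simp only [dyadicPoint]
  congr 1
  rw [pow_succ]
  field_simp

/-- The digraph `Cay(G, S)` of dyadic roots of unity. -/
abbrev dyadicCay : Digraph dyadicCircle := Cay dyadicCircle dyadicGenerators

/-- Since `π / 2ⁿ = 2π / 2ⁿ⁺¹`, the exponent starts at 2: the largest generator is the quarter turn.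
-/
theorem mem_dyadicGenerators_iff {s : dyadicCircle} :
    s ∈ dyadicGenerators ↔ ∃ n, 2 ≤ n ∧ s = dyadicPoint 1 n := by
  have h : ∀ n : ℕ, Circle.exp (Real.pi / 2 ^ n) = dyadicPoint 1 (n + 1) := fun n => by
    simp only [dyadicPoint]
    congr 1
    rw [pow_succ]
    push_cast
    field_simp
  constructor
  · rintro ⟨n, hn, hs⟩
    exact ⟨n + 1, by omega, Subtype.ext (hs.trans (h n))⟩
  · rintro ⟨n, hn, rfl⟩
    obtain ⟨k, rfl⟩ := Nat.exists_eq_add_of_le' hn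
    exact ⟨k + 1, by omega, (h _).symm⟩

theorem step_dyadicCay_iff {z w : dyadicCircle} :
    Step dyadicCay z w ↔ z = w ∨ ∃ n, 2 ≤ n ∧ w = z * dyadicPoint 1 n := by
  refine or_congr Iff.rfl ⟨?_, ?_⟩
  · rintro ⟨s, hs, rfl⟩
    obtain ⟨n, hn, rfl⟩ := mem_dyadicGenerators_iff.mp hs
    exact ⟨n, hn, rfl⟩
  · rintro ⟨n, hn, rfl⟩
    exact ⟨_, mem_dyadicGenerators_iff.mpr ⟨n, hn, rfl⟩, rfl⟩

theorem step_dyadicPoint (m : ℤ) {N : ℕ} (hN : 2 ≤ N) :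
    Step dyadicCay (dyadicPoint m N) (dyadicPoint (m + 1) N) :=
  step_dyadicCay_iff.mpr (Or.inr ⟨N, hN, dyadicPoint_add m 1 N⟩)

theorem reach_one (z : dyadicCircle) : Reach dyadicCay 1 z := by
  obtain ⟨M, hM⟩ := exists_eq_dyadicPoint z
  -- Adding 2 ensures that the unit `2π / 2ᴹ⁺²` is itself a generator; `m` is then reduced to a
  -- natural number of unit steps.
  obtain ⟨m, rfl⟩ := hM (M + 2) (by omega)
  have h : dyadicPoint m (M + 2) = dyadicPoint ((m % 2 ^ (M + 2)).toNat : ℤ) (M + 2) := by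
    rw [Int.toNat_of_nonneg (Int.emod_nonneg _ (by positivity)), dyadicPoint_eq_iff]
    exact Int.dvd_self_sub_emod
  rw [h]
  generalize (m % 2 ^ (M + 2)).toNat = k
  induction k with
  | zero =>
    have : dyadicPoint 0 (M + 2) = 1 := by
      refine Subtype.ext ?_
      simp [dyadicPoint]
    rw [Nat.cast_zero, this]
    exact Relation.ReflTransGen.refl
  | succ k ih =>
    rw [Nat.cast_succ]
    exact Relation.ReflTransGen.tail ih (step_dyadicPoint _ (by omega))

/-- Rounding the argument of a point of the circle down to a multiple of `2π / 2ᴺ`. -/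
def floorMap (N : ℕ) (z : dyadicCircle) : dyadicCircle :=
  dyadicPoint ⌊2 ^ N * (Complex.arg (z : Circle) / (2 * Real.pi))⌋ N

/-- The argument differs from the given angle by `l` full turns, which change the floor by `2ᴺ l`,
invisible modulo `2ᴺ`. Rounding thus becomes integer division. -/
theorem floorMap_dyadicPoint (m : ℤ) (N k : ℕ) :
    floorMap N (dyadicPoint m (N + k)) = dyadicPoint (m / 2 ^ k) N := by
  have hpi := Real.pi_pos
  have h := Circle.exp_arg (dyadicPoint m (N + k) : Circle)
  obtain ⟨l, hl⟩ := Circle.exp_eq_exp.mp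
    (h.trans (show _ = Circle.exp (2 * Real.pi * (m / 2 ^ (N + k))) from rfl))
  rw [floorMap, hl]
  have e : 2 ^ N * ((2 * Real.pi * (m / 2 ^ (N + k)) + l * (2 * Real.pi)) / (2 * Real.pi)) =
      (m : ℝ) / ((2 ^ k : ℕ) : ℝ) + ((2 ^ N * l : ℤ) : ℝ) := by
    push_cast
    rw [pow_add]
    field_simp
  rw [e, Int.floor_add_intCast, Int.floor_div_natCast, Int.floor_intCast, dyadicPoint_eq_iff]
  push_cast
  simp

theorem floorMap_of_le (m : ℤ) {M N : ℕ} (h : M ≤ N) :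
    floorMap N (dyadicPoint m M) = dyadicPoint m M := by
  rw [dyadicPoint_of_le m h]
  have := floorMap_dyadicPoint (m * 2 ^ (N - M)) N 0
  simpa using this

/-- A step with `n ≤ N` is a whole number of units and commutes with rounding. A shorter step moves
the rounded value by 0 or 1 unit, and the unit is a generator because `N ≥ 2`. -/
theorem isStepHom_floorMap {N : ℕ} (hN : 2 ≤ N) : IsStepHom dyadicCay (floorMap N) := by
  intro z w h
  rcases step_dyadicCay_iff.mp h with rfl | ⟨n, hn, rfl⟩
  · exact Or.inl rfl
  obtain ⟨M, hM⟩ := exists_eq_dyadicPoint z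
  obtain ⟨m, rfl⟩ := hM (N + (M + n)) (by omega)
  rw [dyadicPoint_of_le 1 (show n ≤ N + (M + n) by omega), ← dyadicPoint_add,
    floorMap_dyadicPoint, floorMap_dyadicPoint, one_mul]
  rcases le_or_gt n N with hnN | hnN
  · refine step_dyadicCay_iff.mpr (Or.inr ⟨n, hn, ?_⟩)
    rw [show N + (M + n) - n = N - n + (M + n) by omega, pow_add,
      Int.add_mul_ediv_right _ _ (by positivity), dyadicPoint_add, dyadicPoint_of_le 1 hnN, one_mul]
  · have hle : (2 : ℤ) ^ (N + (M + n) - n) ≤ 2 ^ (M + n) :=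
      pow_le_pow_right₀ (by norm_num) (by omega)
    have h₁ : m / 2 ^ (M + n) ≤ (m + 2 ^ (N + (M + n) - n)) / 2 ^ (M + n) :=
      Int.ediv_le_ediv (by positivity) (by simp)
    have h₂ : (m + 2 ^ (N + (M + n) - n)) / 2 ^ (M + n) ≤ m / 2 ^ (M + n) + 1 := by
      rw [← Int.add_mul_ediv_right m 1 (show (2 : ℤ) ^ (M + n) ≠ 0 by positivity)]
      exact Int.ediv_le_ediv (by positivity) (by linarith)
    rcases h₁.eq_or_lt with h | h
    · rw [← h]
      exact Or.inl rfl
    · rw [show (m + 2 ^ (N + (M + n) - n)) / 2 ^ (M + n) = m / 2 ^ (M + n) + 1 by omega]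
      exact step_dyadicPoint _ hN

/-- Passing from `N` to `N + 1` restores one binary digit, which adds 0 or 1 of the finer units. -/
theorem step_floorMap {N : ℕ} (hN : 2 ≤ N) (z : dyadicCircle) :
    Step dyadicCay (floorMap N z) (floorMap (N + 1) z) := by
  obtain ⟨M, hM⟩ := exists_eq_dyadicPoint z
  obtain ⟨m, rfl⟩ := hM (N + 1 + M) (by omega)
  rw [floorMap_dyadicPoint, show N + 1 + M = N + (M + 1) by omega, floorMap_dyadicPoint,
    dyadicPoint_of_le _ (Nat.le_succ N), pow_succ 2 M, ← Int.ediv_ediv_of_nonneg (by positivity)]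
  rcases Int.emod_two_eq (m / 2 ^ M) with h | h
  · refine Or.inl (congrArg (dyadicPoint · _) ?_)
    simp
    omega
  · have : m / 2 ^ M = m / 2 ^ M / 2 * 2 ^ (N + 1 - N) + 1 := by
      simp
      omega
    rw [Nat.succ_eq_add_one]
    conv_rhs => rw [this]
    exact step_dyadicPoint _ (by omega)

theorem exists_floorMap_two_eq (z : dyadicCircle) : ∃ m : ℤ, floorMap 2 z = dyadicPoint m 2 :=
  ⟨_, rfl⟩

theorem eventually_floorMap_eq (z : dyadicCircle) :
    ∀ᶠ N in Filter.atTop, floorMap N z = z := by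
  obtain ⟨M, hM⟩ := exists_eq_dyadicPoint z
  obtain ⟨m, rfl⟩ := hM M le_rfl
  filter_upwards [Filter.eventually_ge_atTop M] with N hN
  exact floorMap_of_le m hN

/-- The arrows between fourth roots of unity are the rotations by a quarter turn. -/
theorem step_dyadicPoint_two_iff {m m' : ℤ} :
    Step dyadicCay (dyadicPoint m 2) (dyadicPoint m' 2) ↔
      (4 : ℤ) ∣ m' - m ∨ (4 : ℤ) ∣ m' - m - 1 := by
  rw [step_dyadicCay_iff, dyadicPoint_eq_iff, ← dvd_neg, neg_sub]
  refine or_congr (by norm_num) ⟨?_, fun h => ⟨2, le_rfl, ?_⟩⟩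
  · rintro ⟨n, hn, h⟩
    obtain ⟨k, rfl⟩ := Nat.exists_eq_add_of_le hn
    rw [dyadicPoint_of_le m' hn, dyadicPoint_of_le m hn, ← dyadicPoint_add, dyadicPoint_eq_iff,
      Nat.add_sub_cancel_left] at h
    cases k with
    | zero =>
      norm_num at h
      rwa [sub_sub]
    | succ k =>
      -- A generator finer than a quarter turn is excluded by parity.
      exfalso
      have h₂ : (2 : ℤ) ∣ m' * 2 ^ (k + 1) - (m * 2 ^ (k + 1) + 1) :=
        (dvd_pow_self 2 (by omega)).trans h
      rw [pow_succ] at h₂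
      generalize (2 : ℤ) ^ k = t at h₂
      rw [← mul_assoc, ← mul_assoc] at h₂
      omega
  · rw [← dyadicPoint_add, dyadicPoint_eq_iff, ← sub_sub]
    norm_num
    exact h

end Dyadic

end PathHomology

end

noncomputable section

/-! ### Quarter-turn paths and the homology in positive degrees. -/

namespace PathHomology

section Coefficients

variable (K : Type u) [CommRing K] {V : Type} {X : Digraph V}

open Classical in
/-- The coefficient of a regular sequence, as a functional on `𝓡ₙ(X)`. -/
def regCoeff {n : ℕ} (y : AccSeq X n) (hy : IsRegular y.1) : Reg K X n →ₗ[K] K :=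
  regLift X (fun x => if x = y then 1 else 0) fun _ hx => if_neg fun h => hx (by rwa [h])

variable {K}

open Classical in
theorem regCoeff_cls {n : ℕ} (y : AccSeq X n) (hy : IsRegular y.1) (x : AccSeq X n) :
    regCoeff K y hy (cls K X x) = if x = y then 1 else 0 := regLift_cls _ _ _

theorem regCoeff_eq_zero {n : ℕ} {y : AccSeq X n} (hy : IsRegular y.1) (hp : ¬ IsPath X y.1)
    {a : Reg K X n} (ha : a ∈ allowed K X n) : regCoeff K y hy a = 0 :=
  allowed_induction (p := fun a => regCoeff K y hy a = 0) ha (by simp)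
    (fun a b h₁ h₂ => by rw [map_add, h₁, h₂, add_zero])
    (fun c a h => by rw [map_smul, h, smul_zero])
    (fun x hx => by rw [regCoeff_cls, if_neg fun h => hp (by rwa [← h])])

end Coefficients

section Rotation

/-- The path of quarter turns starting at `e^{2πij/4}`. -/
def rotation (n : ℕ) (j : ℤ) : AccSeq dyadicCay n :=
  ⟨fun i => dyadicPoint (j + (i : ℕ)) 2, fun i => by
    simp only [Fin.val_succ, Nat.cast_succ, ← add_assoc]
    exact (step_dyadicPoint _ le_rfl).reach⟩

theorem isPath_rotation (n : ℕ) (j : ℤ) : IsPath dyadicCay (rotation n j).1 := fun i => by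
  simp only [rotation, Fin.val_succ, Nat.cast_succ, ← add_assoc]
  exact step_dyadicPoint _ le_rfl

theorem rotation_eq_iff {n : ℕ} {j k : ℤ} : rotation n j = rotation n k ↔ (4 : ℤ) ∣ j - k := by
  have h : ∀ i : ℕ, dyadicPoint (j + i) 2 = dyadicPoint (k + i) 2 ↔ (4 : ℤ) ∣ j - k := fun i => by
    rw [dyadicPoint_eq_iff, add_sub_add_right_eq_sub]
    norm_num
  exact ⟨fun e => (h 0).mp (congrFun (congrArg Subtype.val e) 0),
    fun e => Subtype.ext (funext fun i => (h i).mpr e)⟩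

theorem isRegular_rotation (n : ℕ) (j : ℤ) : IsRegular (rotation n j).1 := fun i h => by
  simp only [rotation, dyadicPoint_eq_iff, Fin.val_succ, Fin.val_castSucc] at h
  push_cast at h
  omega

theorem face_zero_rotation (n : ℕ) (j : ℤ) :
    (rotation (n + 1) j).face 0 = rotation n (j + 1) := by
  refine Subtype.ext (funext fun i => ?_)
  simp only [rotation, AccSeq.face, Fin.succAbove_zero, Fin.val_succ]
  push_cast
  congr 1
  ring

theorem face_last_rotation (n : ℕ) (j : ℤ) :
    (rotation (n + 1) j).face (Fin.last (n + 1)) = rotation n j := by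
  refine Subtype.ext (funext fun i => ?_)
  simp [rotation, AccSeq.face]

theorem face_one_rotation_apply (n : ℕ) (j : ℤ) (k : Fin (n + 2)) :
    ((rotation (n + 2) j).face 1).1 k =
      dyadicPoint (j + if (k : ℕ) = 0 then 0 else (k : ℕ) + 1) 2 := by
  simp only [rotation, AccSeq.face, Fin.val_succAbove_eq_ite, Fin.val_one, Nat.lt_one_iff]
  split_ifs with h
  · simp [h]
  · simp

theorem isRegular_face_one_rotation (n : ℕ) (j : ℤ) :
    IsRegular ((rotation (n + 2) j).face 1).1 := fun k h => by
  rw [face_one_rotation_apply, face_one_rotation_apply, dyadicPoint_eq_iff] at h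
  simp only [Fin.val_castSucc, Fin.val_succ] at h
  push_cast at h
  split_ifs at h <;> omega

/-- Omitting the second vertex leaves a half turn, larger than any generator. -/
theorem not_isPath_face_one_rotation (n : ℕ) (j : ℤ) :
    ¬ IsPath dyadicCay ((rotation (n + 2) j).face 1).1 := fun h => by
  have := h 0
  rw [face_one_rotation_apply, face_one_rotation_apply, step_dyadicPoint_two_iff] at this
  simp at this

/-- Only the face with `i = 1` begins with a half turn, so it occurs in the boundary of a single
rotation. -/
theorem face_rotation_eq_face_one_iff {n : ℕ} {j k : ℤ} (i : Fin (n + 3)) :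
    (rotation (n + 2) j).face i = (rotation (n + 2) k).face 1 ↔ i = 1 ∧ (4 : ℤ) ∣ j - k := by
  constructor
  · intro h
    have h₀ := congrFun (congrArg Subtype.val h) 0
    have h₁ := congrFun (congrArg Subtype.val h) 1
    rw [face_one_rotation_apply] at h₀ h₁
    simp only [rotation, AccSeq.face, Fin.val_succAbove_eq_ite, dyadicPoint_eq_iff] at h₀ h₁
    simp at h₀ h₁
    rw [Fin.ext_iff]
    simp
    split_ifs at h₀ h₁ <;> omega
  · rintro ⟨rfl, h⟩
    rw [rotation_eq_iff.mpr h]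

variable {K : Type u} [CommRing K]

/-- A chain of fourth roots of unity of degree at least `2` whose boundary is spanned by paths
vanishes. -/
theorem eq_zero_of_regD_mem_allowed {n : ℕ} (c : Fin 4 → K)
    (h : regD K dyadicCay (n + 1)
      (∑ j : Fin 4, c j • cls K dyadicCay (rotation (n + 2) (j : ℕ))) ∈
        allowed K dyadicCay (n + 1)) : c = 0 := by
  classical
  funext k
  -- This coefficient of the boundary is `-c k`, and it must vanish because the face is not a path.
  have := regCoeff_eq_zero (isRegular_face_one_rotation n (k : ℕ))
    (not_isPath_face_one_rotation n (k : ℕ)) h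
  simp only [map_sum, map_smul, regD_cls, regCoeff_cls, face_rotation_eq_face_one_iff] at this
  have e : ∀ j : Fin 4, (4 : ℤ) ∣ ((j : ℕ) : ℤ) - ((k : ℕ) : ℤ) ↔ j = k := fun j => by
    rw [Fin.ext_iff]
    omega
  simpa [e, ite_and] using this

/-- The floor map to fourth roots of unity turns path chains into combinations of rotations. -/
theorem exists_regMap_floorMap_eq {n : ℕ} {a : Reg K dyadicCay n}
    (ha : a ∈ allowed K dyadicCay n) :
    ∃ c : Fin 4 → K, regMap K (isStepHom_floorMap le_rfl) n a =
      ∑ j : Fin 4, c j • cls K dyadicCay (rotation n (j : ℕ)) := by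
  classical
  refine allowed_induction (p := fun a => ∃ c : Fin 4 → K,
    regMap K (isStepHom_floorMap le_rfl) n a =
    ∑ j : Fin 4, c j • cls K dyadicCay (rotation n (j : ℕ))) ha ⟨0, by simp⟩ ?_ ?_ ?_
  · rintro a b ⟨c, hc⟩ ⟨d, hd⟩
    exact ⟨c + d, by simp [hc, hd, add_smul, Finset.sum_add_distrib]⟩
  · rintro t a ⟨c, hc⟩
    exact ⟨t • c, by simp [hc, Finset.smul_sum, mul_smul]⟩
  · intro x hx
    rw [regMap_cls]
    by_cases hr : IsRegular (x.map (isStepHom_floorMap le_rfl)).1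
    swap
    · exact ⟨0, by simp [cls_eq_zero hr]⟩
    choose m hm using fun i => exists_floorMap_two_eq (x.1 i)
    -- By regularity every step is exactly a quarter turn, so the image is determined by its first
    -- vertex.
    have hs : ∀ i : Fin n, (4 : ℤ) ∣ m i.succ - m i.castSucc - 1 := fun i => by
      have h₁ := isStepHom_floorMap le_rfl (hx i)
      have h₂ : ¬ floorMap 2 (x.1 i.castSucc) = floorMap 2 (x.1 i.succ) := hr i
      rw [hm, hm] at h₁ h₂
      rw [dyadicPoint_eq_iff] at h₂
      rcases step_dyadicPoint_two_iff.mp h₁ with h | h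
      · exact absurd (by norm_num; omega) h₂
      · exact h
    have hm' : ∀ i : Fin (n + 1), (4 : ℤ) ∣ m i - (m 0 + (i : ℕ)) := fun i => by
      induction i using Fin.induction with
      | zero => simp
      | succ i ih =>
        have := hs i
        rw [Fin.val_succ]
        rw [Fin.val_castSucc] at ih
        push_cast
        omega
    have hj : (m 0 % 4).toNat < 4 := by omega
    have e : x.map (isStepHom_floorMap le_rfl) =
        rotation n (((⟨(m 0 % 4).toNat, hj⟩ : Fin 4) : ℕ) : ℤ) := by
      refine Subtype.ext (funext fun i => ?_)
      change floorMap 2 (x.1 i) = dyadicPoint _ 2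
      rw [hm, dyadicPoint_eq_iff]
      have := hm' i
      norm_num
      omega
    exact ⟨Pi.single ⟨_, hj⟩ 1, by simp [e, Pi.single_apply]⟩

/-- The image is a combination of rotations that still lies in `Omega`, hence is zero. -/
theorem regMap_floorMap_eq_zero {n : ℕ} {a : Reg K dyadicCay (n + 2)}
    (ha : a ∈ Omega K dyadicCay (n + 2)) :
    regMap K (isStepHom_floorMap le_rfl) (n + 2) a = 0 := by
  obtain ⟨c, hc⟩ := exists_regMap_floorMap_eq ha.1
  have h := (mem_Omega_succ.mp (regMap_mem_Omega (isStepHom_floorMap le_rfl) ha)).2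
  rw [hc] at h
  rw [hc, eq_zero_of_regD_mem_allowed c h]
  simp

/-- A chain involves finitely many vertices, each fixed by all sufficiently fine floor maps. -/
theorem exists_regMap_floorMap_eq_self {n : ℕ} (a : Reg K dyadicCay n) :
    ∀ᶠ N in Filter.atTop, regMap K (isStepHom_floorMap (Nat.le_add_left 2 N)) n a = a := by
  obtain ⟨b, rfl⟩ := Submodule.mkQ_surjective _ a
  induction b using Finsupp.induction_linear with
  | zero => simp
  | add b b' h h' =>
    filter_upwards [h, h'] with N h h'
    rw [map_add, map_add, h, h']
  | single x t =>
    have e : (degenerate K dyadicCay n).mkQ (Finsupp.single x t) = t • cls K dyadicCay x := by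
      rw [cls, ← map_smul, Finsupp.smul_single, smul_eq_mul, mul_one]
    have hx : ∀ᶠ N in Filter.atTop, ∀ i, floorMap (N + 2) (x.1 i) = x.1 i :=
      Filter.eventually_all.mpr fun i =>
        (Filter.tendsto_add_atTop_nat 2).eventually (eventually_floorMap_eq (x.1 i))
    filter_upwards [hx] with N hN
    rw [e, map_smul, regMap_cls]
    congr 2
    exact Subtype.ext (funext hN)

/-- The floor maps are all homotopic. -/
theorem exists_regD_eq_regMap_sub {n : ℕ} {a : Reg K dyadicCay (n + 1)}
    (ha : a ∈ Omega K dyadicCay (n + 1)) (hd : regD K dyadicCay n a = 0) (N : ℕ) :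
    ∃ w ∈ Omega K dyadicCay (n + 2), regD K dyadicCay (n + 1) w =
      regMap K (isStepHom_floorMap (Nat.le_add_left 2 N)) (n + 1) a -
        regMap K (isStepHom_floorMap le_rfl) (n + 1) a := by
  induction N with
  | zero => exact ⟨0, zero_mem _, by simp⟩
  | succ N ih =>
    obtain ⟨w, hw, hw'⟩ := ih
    have hs := isStepHom_floorMap (Nat.le_add_left 2 N)
    have ht : IsStepHom dyadicCay (floorMap (N + 2 + 1)) := isStepHom_floorMap (by omega)
    have hst := step_floorMap (Nat.le_add_left 2 N)
    refine ⟨regPrism K hs ht hst (n + 1) a + w, add_mem (regPrism_mem_Omega hs ht hst ha) hw, ?_⟩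
    have key := regD_regPrism_succ hs ht hst a
    rw [hd, map_zero, add_zero] at key
    rw [map_add, key, hw']
    exact sub_add_sub_cancel _ _ _

/-- A cycle of positive degree is homologous to its image under the floor map. -/
theorem exists_regD_eq_sub_regMap {n : ℕ} {a : Reg K dyadicCay (n + 1)}
    (ha : a ∈ Omega K dyadicCay (n + 1)) (hd : regD K dyadicCay n a = 0) :
    ∃ w ∈ Omega K dyadicCay (n + 2), regD K dyadicCay (n + 1) w =
      a - regMap K (isStepHom_floorMap le_rfl) (n + 1) a := by
  obtain ⟨N, hN⟩ := (exists_regMap_floorMap_eq_self a).exists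
  obtain ⟨w, hw, h⟩ := exists_regD_eq_regMap_sub ha hd N
  exact ⟨w, hw, by rw [h, hN]⟩

theorem exists_regD_eq {n : ℕ} {a : Reg K dyadicCay (n + 2)}
    (ha : a ∈ Omega K dyadicCay (n + 2)) (hd : regD K dyadicCay (n + 1) a = 0) :
    ∃ w ∈ Omega K dyadicCay (n + 3), regD K dyadicCay (n + 2) w = a := by
  obtain ⟨w, hw, h⟩ := exists_regD_eq_sub_regMap ha hd
  exact ⟨w, hw, by rw [h, regMap_floorMap_eq_zero ha, sub_zero]⟩

theorem regD_rotation (j : ℤ) : regD K dyadicCay 0 (cls K dyadicCay (rotation 1 j)) =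
    cls K dyadicCay (rotation 0 (j + 1)) - cls K dyadicCay (rotation 0 j) := by
  have hf : (rotation 1 j).face 1 = rotation 0 j := face_last_rotation 0 j
  rw [regD_cls, Fin.sum_univ_two, face_zero_rotation, hf]
  simp [sub_eq_add_neg]

variable (K)

/-- The winding number of a path `1`-chain. -/
def winding : Reg K dyadicCay 1 →ₗ[K] K :=
  regCoeff K (rotation 1 0) (isRegular_rotation 1 0) ∘ₗ regMap K (isStepHom_floorMap le_rfl) 1

variable {K}

theorem winding_regD {w : Reg K dyadicCay 2} (hw : w ∈ Omega K dyadicCay 2) :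
    winding K (regD K dyadicCay 1 w) = 0 := by
  rw [winding, LinearMap.comp_apply, ← regD_regMap, regMap_floorMap_eq_zero hw, map_zero, map_zero]

/-- The floor image is a cycle on the square, so its four coefficients coincide; their common value
is the winding number. -/
theorem exists_regD_eq_of_winding_eq_zero {a : Reg K dyadicCay 1}
    (ha : a ∈ Omega K dyadicCay 1) (hd : regD K dyadicCay 0 a = 0) (hw : winding K a = 0) :
    ∃ w ∈ Omega K dyadicCay 2, regD K dyadicCay 1 w = a := by
  classical
  obtain ⟨w, hw₁, h⟩ := exists_regD_eq_sub_regMap ha hd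
  refine ⟨w, hw₁, ?_⟩
  obtain ⟨c, hc⟩ := exists_regMap_floorMap_eq (n := 1) ha.1
  have hb := regD_regMap (n := 0) (isStepHom_floorMap le_rfl) a
  rw [hd, map_zero, hc] at hb
  rw [winding, LinearMap.comp_apply, hc] at hw
  have h₀ : c 0 = 0 := by
    simpa [regCoeff_cls, rotation_eq_iff, Fin.sum_univ_four] using hw
  -- At the vertex `k` the boundary has coefficient `c (k - 1) - c k`, indices modulo 4.
  have hk : ∀ k : ℤ, regCoeff K (rotation 0 k) (isRegular_rotation 0 k) _ = 0 := fun k =>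
    (congrArg _ hb).trans (map_zero _)
  simp only [map_sum, map_smul, regD_rotation, map_sub, regCoeff_cls, rotation_eq_iff] at hk
  have h₁ := hk 1
  have h₂ := hk 2
  have h₃ := hk 3
  simp [Fin.sum_univ_four, h₀] at h₁
  simp [Fin.sum_univ_four, h₀, h₁] at h₂
  simp [Fin.sum_univ_four, h₀, h₁, h₂] at h₃
  refine h.trans ?_
  rw [hc, Fin.sum_univ_four, h₀, h₁, h₂, h₃]
  simp

variable (K)

/-- The fundamental cycle: the sum of the four quarter turns. -/
def fundamentalCycle : Reg K dyadicCay 1 := ∑ j : Fin 4, cls K dyadicCay (rotation 1 (j : ℕ))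

theorem regD_fundamentalCycle : regD K dyadicCay 0 (fundamentalCycle K) = 0 := by
  have h : rotation 0 4 = rotation 0 0 := rotation_eq_iff.mpr (by norm_num)
  simp [fundamentalCycle, regD_rotation, Fin.sum_univ_four, -map_sum, map_add]
  norm_num [h]

theorem fundamentalCycle_mem_Omega : fundamentalCycle K ∈ Omega K dyadicCay 1 := by
  refine mem_Omega_succ.mpr
    ⟨Submodule.sum_mem _ fun j _ => cls_mem_allowed (isPath_rotation 1 _), ?_⟩
  rw [regD_fundamentalCycle]
  exact zero_mem _

theorem winding_fundamentalCycle : winding K (fundamentalCycle K) = 1 := by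
  classical
  have h : ∀ j : ℤ, (rotation 1 j).map (isStepHom_floorMap le_rfl) = rotation 1 j := fun j =>
    Subtype.ext (funext fun i => floorMap_of_le _ le_rfl)
  simp only [winding, fundamentalCycle, LinearMap.comp_apply, map_sum, regMap_cls, h, regCoeff_cls,
    rotation_eq_iff]
  rw [Fin.sum_univ_four]
  norm_num

end Rotation

/-! ### Degree zero: reachability from one vertex. -/

section DegreeZero

variable {K : Type u} [CommRing K] {V : Type} {X : Digraph V}

theorem mem_allowed_zero (a : Reg K X 0) : a ∈ allowed K X 0 := by
  have h : (allowed K X 0).mkQ = 0 := reg_hom_ext fun x =>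
    (Submodule.Quotient.mk_eq_zero _).mpr (cls_mem_allowed fun i => i.elim0)
  exact (Submodule.Quotient.mk_eq_zero _).mp (LinearMap.congr_fun h a)

variable (K X) in
/-- The augmentation of `0`-chains. -/
def augmentation : Reg K X 0 →ₗ[K] K :=
  regLift X (fun _ => 1) fun _ hx => absurd (fun i => i.elim0) hx

theorem augmentation_cls (x : AccSeq X 0) : augmentation K X (cls K X x) = 1 := regLift_cls _ _ _

theorem augmentation_regD (w : Reg K X 1) : augmentation K X (regD K X 0 w) = 0 := by
  refine LinearMap.congr_fun (f := augmentation K X ∘ₗ regD K X 0) (g := 0)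
    (reg_hom_ext fun x => ?_) w
  simp [regD_cls, augmentation_cls, Fin.sum_univ_two, -map_sum, map_add]

variable (X) in
/-- A vertex as an accessible sequence. -/
def AccSeq.point (x : V) : AccSeq X 0 := ⟨fun _ => x, fun i => i.elim0⟩

theorem exists_regD_eq_cls_point_sub {x y : V} (h : Reach X x y) :
    ∃ w ∈ Omega K X 1, regD K X 0 w =
      cls K X (AccSeq.point X y) - cls K X (AccSeq.point X x) := by
  induction h with
  | refl => exact ⟨0, zero_mem _, by simp⟩
  | @tail y z _ hyz ih =>
    obtain ⟨w, hw, hw'⟩ := ih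
    have hp : IsPath X (n := 1) ![y, z] := fun i => by
      fin_cases i
      exact hyz
    let e : AccSeq X 1 := ⟨![y, z], hp.isAccessible⟩
    have h₀ : e.face 0 = AccSeq.point X z := Subtype.ext (funext fun i => by
      fin_cases i
      rfl)
    have h₁ : e.face 1 = AccSeq.point X y := Subtype.ext (funext fun i => by
      fin_cases i
      rfl)
    refine ⟨cls K X e + w, add_mem (mem_Omega_succ.mpr ⟨cls_mem_allowed hp, mem_allowed_zero _⟩) hw,
      ?_⟩
    rw [map_add, hw', regD_cls, Fin.sum_univ_two, h₀, h₁]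
    simp [← sub_eq_add_neg]

theorem exists_regD_eq_of_augmentation_eq_zero {x : V} (hx : ∀ y, Reach X x y) {a : Reg K X 0}
    (ha : augmentation K X a = 0) : ∃ w ∈ Omega K X 1, regD K X 0 w = a := by
  let R := (Omega K X 1).map (regD K X 0)
  -- Modulo boundaries every vertex equals `x`, so a chain is its augmentation times the class of
  -- `x`.
  have h : R.mkQ = (augmentation K X).smulRight (R.mkQ (cls K X (AccSeq.point X x))) :=
    reg_hom_ext fun y => by
      rw [LinearMap.smulRight_apply, augmentation_cls, one_smul, ← sub_eq_zero, ← map_sub]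
      have hy : y = AccSeq.point X (y.1 0) := Subtype.ext (funext fun i => by
        fin_cases i
        rfl)
      rw [hy]
      exact (Submodule.Quotient.mk_eq_zero _).mpr (exists_regD_eq_cls_point_sub (hx _))
  have h₁ := LinearMap.congr_fun h a
  rw [LinearMap.smulRight_apply, ha, zero_smul] at h₁
  exact (Submodule.Quotient.mk_eq_zero R).mp h₁

end DegreeZero

end PathHomology

end

/-- A short complex of modules whose cycles modulo boundaries are detected by a functional. -/
theorem CategoryTheory.ShortComplex.nonempty_homology_iso_of_functional {K : Type u} [CommRing K]
    (S : ShortComplex (ModuleCat.{u} K)) (φ : S.X₂ →ₗ[K] K) (hφ : ∀ w, φ (S.f.hom w) = 0)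
    (ζ : S.X₂) (hζ : S.g.hom ζ = 0) (hφζ : φ ζ = 1)
    (h : ∀ z, S.g.hom z = 0 → φ z = 0 → ∃ w, S.f.hom w = z) :
    Nonempty (S.homology ≅ ModuleCat.of K K) := by
  let ψ : LinearMap.ker S.g.hom →ₗ[K] K := φ.domRestrict _
  have hψ : Function.Surjective ψ := fun t => ⟨t • ⟨ζ, hζ⟩, by simp [ψ, hφζ]⟩
  have hk : LinearMap.ker ψ = LinearMap.range S.moduleCatToCycles := by
    ext z
    constructor
    · intro hz
      obtain ⟨w, hw⟩ := h z.1 z.2 hz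
      exact ⟨w, Subtype.ext hw⟩
    · rintro ⟨w, rfl⟩
      exact hφ w
  exact ⟨S.moduleCatHomologyIso ≪≫ ((Submodule.quotEquivOfEq _ _ hk).symm.trans
    (ψ.quotKerEquivOfSurjective hψ)).toModuleIso⟩

/-! ### Path homology of the Cayley digraph, and the comparison. -/

namespace PathHomology

variable (K : Type u) [CommRing K] {V : Type} (X : Digraph V)

theorem omegaComplex_d_hom (n : ℕ) : ((omegaComplex K X).d (n + 1) n).hom = omegaD K X n :=
  congrArg ModuleCat.Hom.hom (ChainComplex.of_d (fun n => ModuleCat.of K (Omega K X n))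
    (fun n => ModuleCat.ofHom (omegaD K X n)) n)

theorem nonempty_PH_zero_iso : Nonempty (PH K dyadicCay 0 ≅ ModuleCat.of K K) := by
  -- The successor of 0 in the complex shape is 0 itself, and the outgoing differential there is
  -- zero.
  have e := (omegaComplex K dyadicCay).isoSc' 1 0 0 (by simp) (by simp)
  obtain ⟨i⟩ := ShortComplex.nonempty_homology_iso_of_functional
    ((omegaComplex K dyadicCay).sc' 1 0 0)
    (augmentation K dyadicCay ∘ₗ (Omega K dyadicCay 0).subtype)
    (fun w => by
      change (augmentation K dyadicCay ∘ₗ (Omega K dyadicCay 0).subtype)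
        (((omegaComplex K dyadicCay).d 1 0).hom w) = _
      rw [omegaComplex_d_hom]
      exact augmentation_regD _)
    ⟨cls K dyadicCay (AccSeq.point _ 1), mem_allowed_zero _⟩
    (by
      change ((omegaComplex K dyadicCay).d 0 0).hom _ = _
      rw [(omegaComplex K dyadicCay).shape 0 0 (by simp)]
      rfl)
    (augmentation_cls _)
    (fun z _ hz => by
      obtain ⟨w, hw, h⟩ := exists_regD_eq_of_augmentation_eq_zero reach_one hz
      refine ⟨⟨w, hw⟩, ?_⟩
      change ((omegaComplex K dyadicCay).d 1 0).hom _ = _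
      rw [omegaComplex_d_hom]
      exact Subtype.ext h)
  exact ⟨ShortComplex.homologyMapIso e ≪≫ i⟩

theorem nonempty_PH_one_iso : Nonempty (PH K dyadicCay 1 ≅ ModuleCat.of K K) := by
  have e := (omegaComplex K dyadicCay).isoSc' 2 1 0 (by simp) (by simp)
  obtain ⟨i⟩ := ShortComplex.nonempty_homology_iso_of_functional
    ((omegaComplex K dyadicCay).sc' 2 1 0)
    (winding K ∘ₗ (Omega K dyadicCay 1).subtype)
    (fun w => by
      change (winding K ∘ₗ (Omega K dyadicCay 1).subtype)
        (((omegaComplex K dyadicCay).d 2 1).hom w) = _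
      rw [omegaComplex_d_hom]
      exact winding_regD w.2)
    ⟨fundamentalCycle K, fundamentalCycle_mem_Omega K⟩
    (by
      change ((omegaComplex K dyadicCay).d 1 0).hom _ = _
      rw [omegaComplex_d_hom]
      exact Subtype.ext (regD_fundamentalCycle K))
    (winding_fundamentalCycle K)
    (fun z hz hz' => by
      change ((omegaComplex K dyadicCay).d 1 0).hom _ = _ at hz
      rw [omegaComplex_d_hom] at hz
      obtain ⟨w, hw, h⟩ := exists_regD_eq_of_winding_eq_zero z.2 (congrArg Subtype.val hz) hz'
      refine ⟨⟨w, hw⟩, ?_⟩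
      change ((omegaComplex K dyadicCay).d 2 1).hom _ = _
      rw [omegaComplex_d_hom]
      exact Subtype.ext h)
  exact ⟨ShortComplex.homologyMapIso e ≪≫ i⟩

theorem isZero_PH (n : ℕ) : Limits.IsZero (PH K dyadicCay (n + 2)) := by
  refine HomologicalComplex.ExactAt.isZero_homology ?_
  rw [(omegaComplex K dyadicCay).exactAt_iff' (n + 3) (n + 2) (n + 1) (by simp) (by simp),
    ShortComplex.moduleCat_exact_iff]
  intro z hz
  change ((omegaComplex K dyadicCay).d (n + 2) (n + 1)).hom _ = _ at hz
  rw [omegaComplex_d_hom] at hz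
  obtain ⟨w, hw, h⟩ := exists_regD_eq z.2 (congrArg Subtype.val hz)
  refine ⟨⟨w, hw⟩, ?_⟩
  change ((omegaComplex K dyadicCay).d (n + 3) (n + 2)).hom _ = _
  rw [omegaComplex_d_hom]
  exact Subtype.ext h

end PathHomology

theorem mainTheorem11 (K : Type u) [CommRing K] (n : ℕ) :
    Nonempty
      (PathHomology.PH K
          (PathHomology.Cay PathHomology.dyadicCircle PathHomology.dyadicGenerators) n ≅
        ((AlgebraicTopology.singularHomologyFunctor (ModuleCat.{u} K) n).obj
          (ModuleCat.of K K)).obj (TopCat.of Circle)) := by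
  match n with
  | 0 =>
    exact (PathHomology.nonempty_PH_zero_iso K).map2 (fun i j => i ≪≫ j.symm)
      (nonempty_singularHomology_circle_zero_iso K)
  | 1 =>
    exact (PathHomology.nonempty_PH_one_iso K).map2 (fun i j => i ≪≫ j.symm)
      (nonempty_singularHomology_circle_one_iso K)
  | n + 2 => exact ⟨(PathHomology.isZero_PH K n).iso (isZero_singularHomology_circle K n)⟩
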